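/- **Model.** Let $f:\mathbb R\to[0,1]$ be an increasing, twice differentiable link function and let $d_1\le d_0$ be reals. Put $F(t\mid x)=1$ for $t\le-1$, $F(0\mid x)=f(d_0+x)$, $F(1\mid x)=f(d_1+x)$, $F(t\mid x)=0$ for $t\ge2$, and $p(t\mid x)=F(t\mid x)-F(t+1\mid x)$. For $\alpha\ge0$ let $$G_\alpha=\max_{t\in\{-1,0,1\}}\sup_{|x|\le\alpha}\frac{|p'(t\mid x)|}{p(t\mid x)},\qquad H_\alpha=\min_{t\in\{-1,0,1\}}\inf_{|x|\le\alpha}\Big\{\frac{p'(t\mid x)^2}{p(t\mid x)^2}-\frac{p''(t\mid x)}{p(t\mid x)}\Big\}.$$ Fix $K_1,K_2$, constants $C,\kappa>0$, and $a_n>0$ with $a_n\to0$; let $K=K_1+K_2$ and $\alpha=5C^2+\max(d_0,0)$ (so $\alpha=5C^2+d_0$ if $d_0\ge0$), $G=G_\alpha$, $H=H_\alpha$. For every $n$ let $\mathbf B^*\in\mathbb R^{n\times K_1}$, $\mathbf A^*\in\mathbb R^{n\times K_2}$ (depending on $n$) have rows $\beta_i^*,\alpha_i^*$, and let $\mathbf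 Y=(y_{ij})$ be a symmetric random $n\times n$ matrix with entries in $\{-1,0,1\}$, with $y_{ij}$, $i\le j$, independent and $\Pr(y_{ij}\ge t)=F(t\mid m^*_{ij})$, where $m_{ij}^*=-\|\beta_i^*-\beta_j^*\|^2+\langle\alpha_i^*,\alpha_j^*\rangle$. **Estimator.** $(\widehat{\mathbf B},\widehat{\mathbf A})$ is any minimiser of $-\sum_{i,j=1}^n\log p(y_{ij}\mid -\|\beta_i-\beta_j\|^2+\langle\alpha_i,\alpha_j\rangle)$ over $\mathbf B\in\mathbb R^{n\times K_1}$, $\mathbf A\in\mathbb R^{n\times K_2}$ with all rows of norm at most $C$, $\mathbf 1^\top\mathbf B=0$, $\mathbf 1^\top\mathbf A=0$, $\mathbf B^\top\mathbf A=0$ and $\|\mathbf A\|_F\le\kappa\sqrt{a_n}\,\|\mathbf B\|_F$. **Conditions.** - A1: all rows of $\mathbf B^*$ and $\mathbf A^*$ have norm at most $C$; $G<\infty$ and $H>0$. - A2: $\mathbf 1^\top\mathbf B^*=0$, $\mathbf 1^\top\mathbf A^*=0$, $(\mathbf B^*)^\top\mathbf A^*=0$. - A3: $\frac1n(\mathbf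 B^*)^\top\mathbf B^*\to\boldsymbol\Sigma_1$ and $\frac1{na_n}(\mathbf A^*)^\top\mathbf A^*\to\boldsymbol\Sigma_2$, where $\boldsymbol\Sigma_1,\boldsymbol\Sigma_2$ are positive definite, each with pairwise distinct eigenvalues, and $\operatorname{tr}\boldsymbol\Sigma_2<\kappa^2\operatorname{tr}\boldsymbol\Sigma_1$. - A4 (signed stochastic block model): there are $m$ points $b_1,\dots,b_m\in\mathbb R^{K_1}$ and labels $\psi_i^*\in[m]$ with $\beta_i^*=b_{\psi_i^*}$ for all $i$; $m$, the $b_l$ and the labels may depend on $n$. Let $\mathcal N_l^*=\{i:\psi_i^*=l\}$, $\xi_n=\min_l|\mathcal N_l^*|/n$, $\zeta_n=\min_{l<k}\|b_l-b_k\|$ and $r_n=4.02\sqrt{2(K+2)/n}\;G/H$. **Theorem.** There are universal constants $C_1,C_2>0$ such that for all $\varepsilon\ge0$ and $0<\lambda\le\Lambda$ there is a constant $c>0$, depending only on $\varepsilon,\lambda,\Lambda$, with the following property. Suppose that A1–A4 hold, that the eigenvalues of $\boldsymbol\Sigma_1$ lie in $[\lambda,\Lambda]$, and that $K_1r_n^2=o(\xi_n\zeta_n^2)$.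 Then for all sufficiently large $n$, with probability at least $1-C_1\exp(-C_2n)$, for every minimiser $(\widehat{\mathbf B},\widehat{\mathbf A})$ and every $(1+\varepsilon)$-approximate solution of the $K$-means problem with $m$ clusters for the rows of $\widehat{\mathbf B}$, with clusters $\widehat{\mathcal N}_1,\dots,\widehat{\mathcal N}_m$, $$\min_{p}\frac1n\sum_{l=1}^m|\mathcal N_l^*\setminus\widehat{\mathcal N}_{p_l}|\le c\,\frac{K_1(K+2)G^2}{H^2n\zeta_n^2}\quad\text{and}\quad\min_{p}\max_{1\le l\le m}\frac{|\mathcal N_l^*\setminus\widehat{\mathcal N}_{p_l}|}{|\mathcal N_l^*|}\le c\,\frac{K_1(K+2)G^2}{H^2n\xi_n\zeta_n^2},$$ where $p$ ranges over the permutations of $[m]$. If moreover $\xi_n$ and $\zeta_n$ are bounded away from zero, then both right-hand sides are $O(1/n)$. -/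

import Mathlib

open Filter Topology MeasureTheory ProbabilityTheory Asymptotics

namespace SignedNet

/-! ### The ordinal edge model -/

/-- An admissible link function: increasing, with values in `[0, 1]`, and twice differentiable. -/
structure IsLink (f : ℝ → ℝ) : Prop where
  monotone : Monotone f
  mem_unit : ∀ x, f x ∈ Set.Icc (0 : ℝ) 1
  diff : Differentiable ℝ f
  diff_deriv : Differentiable ℝ (deriv f)

/-- `F(t | x) = Pr(y ≥ t | x)`, the upper-tail function of an edge whose parameter is `x`. -/
noncomputable def tailF (f : ℝ → ℝ) (d₀ d₁ : ℝ) (t : ℤ) (x : ℝ) : ℝ :=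
  if t ≤ -1 then 1
  else if t = 0 then f (d₀ + x)
  else if t = 1 then f (d₁ + x)
  else 0

/-- `p(t | x) = F(t | x) - F(t + 1 | x)`. -/
noncomputable def pmfP (f : ℝ → ℝ) (d₀ d₁ : ℝ) (t : ℤ) (x : ℝ) : ℝ :=
  tailF f d₀ d₁ t x - tailF f d₀ d₁ (t + 1) x

/-- The support `{-1, 0, 1}` of an edge. -/
def edgeSupport : Set ℤ := {-1, 0, 1}

/-- The values `|p'(t | x)| / p(t | x)`, for `t ∈ {-1, 0, 1}` and `|x| ≤ α`. -/
def steepnessSet (f : ℝ → ℝ) (d₀ d₁ α : ℝ) : Set ℝ :=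
  {y | ∃ t ∈ edgeSupport, ∃ x : ℝ, |x| ≤ α ∧
    y = |deriv (pmfP f d₀ d₁ t) x| / pmfP f d₀ d₁ t x}

/-- The values `p'(t | x)² / p(t | x)² - p''(t | x) / p(t | x)`, for `t ∈ {-1, 0, 1}`
and `|x| ≤ α`. -/
def flatnessSet (f : ℝ → ℝ) (d₀ d₁ α : ℝ) : Set ℝ :=
  {y | ∃ t ∈ edgeSupport, ∃ x : ℝ, |x| ≤ α ∧
    y = (deriv (pmfP f d₀ d₁ t) x) ^ 2 / (pmfP f d₀ d₁ t x) ^ 2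
      - deriv (deriv (pmfP f d₀ d₁ t)) x / pmfP f d₀ d₁ t x}

/-- `G_α`; it is finite when `steepnessSet` is bounded above. -/
noncomputable def constG (f : ℝ → ℝ) (d₀ d₁ α : ℝ) : ℝ := sSup (steepnessSet f d₀ d₁ α)

/-- `H_α`. If `flatnessSet` is not bounded below this is `0`, so the condition
`H_α > 0` has its usual meaning. -/
noncomputable def constH (f : ℝ → ℝ) (d₀ d₁ α : ℝ) : ℝ := sInf (flatnessSet f d₀ d₁ α)

/-- The radius `5 C² + max (d₀, 0)`; it is `5 C² + d₀` for `d₀ ≥ 0`. -/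
noncomputable def radius (C d₀ : ℝ) : ℝ := 5 * C ^ 2 + max d₀ 0

/-! ### Embeddings -/

/-- An `n × K` matrix, given by its rows in Euclidean `K`-space. -/
abbrev Emb (n K : ℕ) := Fin n → EuclideanSpace ℝ (Fin K)

/-- `m i j = -‖β i - β j‖² + ⟨α i, α j⟩`. -/
noncomputable def paramM {n K₁ K₂ : ℕ} (B : Emb n K₁) (A : Emb n K₂) (i j : Fin n) : ℝ :=
  -‖B i - B j‖ ^ 2 + inner ℝ (A i) (A j)

/-- The matrix `Xᵀ X`. -/
def gramMatrix {n K : ℕ} (X : Emb n K) : Matrix (Fin K) (Fin K) ℝ :=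
  Matrix.of fun k l => ∑ i, X i k * X i l

/-- The Frobenius norm. -/
noncomputable def frobNorm {n K : ℕ} (X : Emb n K) : ℝ := √(∑ i, ‖X i‖ ^ 2)

/-- Both embeddings are centred, and `Bᵀ A = 0`. -/
structure CentredOrth {n K₁ K₂ : ℕ} (B : Emb n K₁) (A : Emb n K₂) : Prop where
  sum_B : ∑ i, B i = 0
  sum_A : ∑ i, A i = 0
  orth : ∀ k l, ∑ i, B i k * A i l = 0

/-- `Y` is a random signed network with parameter matrix `M`: a symmetric random matrix with
entries in `{-1, 0, 1}`, independent on and above the diagonal, with upper tails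
`F(t | M i j)`. -/
structure IsSignedNetwork {Ω : Type*} [MeasurableSpace Ω] (P : Measure Ω) {n : ℕ}
    (f : ℝ → ℝ) (d₀ d₁ : ℝ) (M : Fin n → Fin n → ℝ) (Y : Ω → Fin n → Fin n → ℤ) : Prop where
  measurable : ∀ i j, Measurable fun ω => Y ω i j
  symm : ∀ ω i j, Y ω i j = Y ω j i
  mem_support : ∀ ω i j, Y ω i j ∈ edgeSupport
  law : ∀ i j t, P.real {ω | t ≤ Y ω i j} = tailF f d₀ d₁ t (M i j)
  indep : iIndepFun (fun (e : {e : Fin n × Fin n // e.1 ≤ e.2}) ω => Y ω e.1.1 e.1.2) P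

/-! ### The estimator -/

/-- The log-likelihood of the observed network `y` at `(B, A)`. -/
noncomputable def logLik {n K₁ K₂ : ℕ} (f : ℝ → ℝ) (d₀ d₁ : ℝ) (y : Fin n → Fin n → ℤ)
    (B : Emb n K₁) (A : Emb n K₂) : ℝ :=
  ∑ i, ∑ j, Real.log (pmfP f d₀ d₁ (y i j) (paramM B A i j))

/-- The constraint set of the estimation problem. -/
structure Feasible {n K₁ K₂ : ℕ} (C κ a : ℝ) (B : Emb n K₁) (A : Emb n K₂) : Prop where
  bound_B : ∀ i, ‖B i‖ ≤ C
  bound_A : ∀ i, ‖A i‖ ≤ C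
  centredOrth : CentredOrth B A
  scale : frobNorm A ≤ κ * √a * frobNorm B

/-- `(B, A)` minimises the negative log-likelihood of `y` under the constraints. -/
def IsEstimate {n K₁ K₂ : ℕ} (f : ℝ → ℝ) (d₀ d₁ C κ a : ℝ) (y : Fin n → Fin n → ℤ)
    (B : Emb n K₁) (A : Emb n K₂) : Prop :=
  Feasible C κ a B A ∧
    ∀ (B' : Emb n K₁) (A' : Emb n K₂), Feasible C κ a B' A' →
      -logLik f d₀ d₁ y B A ≤ -logLik f d₀ d₁ y B' A'

/-! ### K-means and community structure -/

/-- The K-means cost of the assignment `ψ` with centres `x`. -/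
noncomputable def kmeansCost {n K m : ℕ} (X : Emb n K) (ψ : Fin n → Fin m) (x : Emb m K) : ℝ :=
  ∑ i, ‖X i - x (ψ i)‖ ^ 2

/-- `ψ`, with suitable centres, is a `(1 + ε)`-approximate solution of the K-means problem
with `m` clusters for the rows of `X`. -/
def IsApproxKMeans {n K m : ℕ} (ε : ℝ) (X : Emb n K) (ψ : Fin n → Fin m) : Prop :=
  ∃ x : Emb m K, ∀ (ψ' : Fin n → Fin m) (x' : Emb m K),
    kmeansCost X ψ x ≤ (1 + ε) * kmeansCost X ψ' x'

/-- The community with index `l`. -/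
def community {n m : ℕ} (ψ : Fin n → Fin m) (l : Fin m) : Finset (Fin n) :=
  Finset.univ.filter fun i => ψ i = l

/-- `ξ`, the proportion of nodes in the smallest community. -/
noncomputable def minProportion {n m : ℕ} (ψ : Fin n → Fin m) : ℝ :=
  ⨅ l : Fin m, ((community ψ l).card : ℝ) / n

/-- `ζ`, the minimal distance between two community centres (only used with at least two
communities; its value is `0` otherwise). -/
noncomputable def minSeparation {m K : ℕ} (b : Emb m K) : ℝ :=
  ⨅ q : {q : Fin m × Fin m // q.1 < q.2}, ‖b q.1.1 - b q.1.2‖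

/-- The overall proportion of misclustered nodes, minimised over relabellings. -/
noncomputable def overallError {n m : ℕ} (ψ ψhat : Fin n → Fin m) : ℝ :=
  ⨅ p : Equiv.Perm (Fin m),
    (1 / (n : ℝ)) * ∑ l, ((community ψ l \ community ψhat (p l)).card : ℝ)

/-- The worst-case proportion of misclustered nodes in a community, minimised over
relabellings. -/
noncomputable def worstError {n m : ℕ} (ψ ψhat : Fin n → Fin m) : ℝ :=
  ⨅ p : Equiv.Perm (Fin m), ⨆ l : Fin m,
    ((community ψ l \ community ψhat (p l)).card : ℝ) / ((community ψ l).card : ℝ)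

/-! ### The conditions, for a sequence of models indexed by the number `n` of nodes -/

/-- The true embeddings are bounded by `C`, and `G < ∞`, `H > 0` on the feasible domain. -/
structure CondA1 {K₁ K₂ : ℕ} (f : ℝ → ℝ) (d₀ d₁ C : ℝ)
    (B : (n : ℕ) → Emb n K₁) (A : (n : ℕ) → Emb n K₂) : Prop where
  bound_B : ∀ n i, ‖B n i‖ ≤ C
  bound_A : ∀ n i, ‖A n i‖ ≤ C
  G_finite : BddAbove (steepnessSet f d₀ d₁ (radius C d₀))
  H_pos : 0 < constH f d₀ d₁ (radius C d₀)

/-- Centring and orthogonality of the true embeddings. -/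
def CondA2 {K₁ K₂ : ℕ} (B : (n : ℕ) → Emb n K₁) (A : (n : ℕ) → Emb n K₂) : Prop :=
  ∀ n, CentredOrth (B n) (A n)

/-- Convergence of the scaled Gram matrices to positive definite limits with simple
spectra. -/
structure CondA3 {K₁ K₂ : ℕ} (κ : ℝ) (a : ℕ → ℝ)
    (B : (n : ℕ) → Emb n K₁) (A : (n : ℕ) → Emb n K₂)
    (S₁ : Matrix (Fin K₁) (Fin K₁) ℝ) (S₂ : Matrix (Fin K₂) (Fin K₂) ℝ) : Prop where
  posDef₁ : S₁.PosDef
  posDef₂ : S₂.PosDef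
  trace_lt : S₂.trace < κ ^ 2 * S₁.trace
  tendsto₁ : Tendsto (fun n : ℕ => (1 / (n : ℝ)) • gramMatrix (B n)) atTop (𝓝 S₁)
  tendsto₂ : Tendsto (fun n : ℕ => (1 / ((n : ℝ) * a n)) • gramMatrix (A n)) atTop (𝓝 S₂)
  simple₁ : StrictAnti posDef₁.isHermitian.eigenvalues₀
  simple₂ : StrictAnti posDef₂.isHermitian.eigenvalues₀

/-- The signed stochastic block model: with `n` nodes, node `i` lies in the community `ψ n i`
among `m n` communities, and its embedding is the centre of that community. -/
def CondA4 {K₁ : ℕ} (B : (n : ℕ) → Emb n K₁) (m : ℕ → ℕ) (b : (n : ℕ) → Emb (m n) K₁)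
    (ψ : (n : ℕ) → Fin n → Fin (m n)) : Prop :=
  ∀ n i, B n i = b n (ψ n i)

/-- The rate `r_n = 4.02 √(2 (K + 2) / n) G / H`. -/
noncomputable def rate (K : ℕ) (G H : ℝ) (n : ℕ) : ℝ :=
  4.02 * √(2 * ((K : ℝ) + 2) / n) * G / H

/-- The bound `c K₁ (K + 2) G² / (H² n s)`, with `K = K₁ + K₂`. -/
noncomputable def errorBound (c : ℝ) (K₁ K₂ : ℕ) (G H : ℝ) (n : ℕ) (s : ℝ) : ℝ :=
  c * ((K₁ : ℝ) * (((K₁ + K₂ : ℕ) : ℝ) + 2) * G ^ 2) / (H ^ 2 * (n * s))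

end SignedNet

/-! The likelihood controls the parameter matrix, the parameter matrix controls `B` up to an
invertible linear map, and K-means tolerates such a map.

Let `D` be the estimated minus the true parameter matrix and `W` the matrix of scores at the truth.
Each edge log-likelihood is strongly concave with modulus `H` on the range of feasible parameters
(`IsLink.log_pmfP_sub_le`), and for large `n` the truth is feasible, so optimality gives (H/2)‖D‖_F²
≤ ⟨W, D⟩. As `D` has low rank, ⟨W, D⟩ ≤ ‖W‖ √(2(K+2)) ‖D‖_F. The scores are centred, bounded by `G`
and independent on and above the diagonal, so a net argument gives ‖W‖ ≤ 18 G √n outside an event of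
probability at most exp(-n). All the randomness is in this step; the rest is deterministic
(`IsEstimate.errors_le`).

Centring separates the squared norms in `D` from the Gram part, so the error of 2BBᵀ + AAᵀ is at
most ‖D‖_F. Since BᵀA = 0 and a_n → 0 makes `A` small beside `B`, `exists_alignment` gives a matrix
`Q` with ‖B̂ - BQ‖_F² of order (K+2)G²/H². `Q` need not be orthogonal: a lower bound for Qᵀ keeps
the transformed centres separated. The true labels then have small K-means cost, so few nodes are
fitted far from their own centre; the rate condition makes this exceptional set smaller than every
community, which yields the permutation (`IsApproxKMeans.exists_perm`). -/

namespace SignedNet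

/-! ### Strong concavity of the edge log-likelihood -/

section Link

variable {f : ℝ → ℝ} {d₀ d₁ : ℝ}

lemma IsLink.hasDerivAt (hf : IsLink f) (d x : ℝ) :
    HasDerivAt (fun x => f (d + x)) (deriv f (d + x)) x := by
  have := (hf.diff (d + x)).hasDerivAt.comp x ((hasDerivAt_id x).const_add d)
  simpa [Function.comp_def] using this

/-- The derivative of the upper-tail function. -/
noncomputable def tailDeriv (f : ℝ → ℝ) (d₀ d₁ : ℝ) (t : ℤ) (x : ℝ) : ℝ :=
  if t ≤ -1 then 0
  else if t = 0 then deriv f (d₀ + x)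
  else if t = 1 then deriv f (d₁ + x)
  else 0

lemma IsLink.hasDerivAt_tailF (hf : IsLink f) (t : ℤ) (x : ℝ) :
    HasDerivAt (tailF f d₀ d₁ t) (tailDeriv f d₀ d₁ t x) x := by
  unfold tailF tailDeriv
  split_ifs
  · exact hasDerivAt_const x 1
  · exact hf.hasDerivAt d₀ x
  · exact hf.hasDerivAt d₁ x
  · exact hasDerivAt_const x 0

lemma IsLink.differentiable_tailDeriv (hf : IsLink f) (t : ℤ) :
    Differentiable ℝ (tailDeriv f d₀ d₁ t) := by
  unfold tailDeriv
  have h (d : ℝ) : Differentiable ℝ fun x => deriv f (d + x) :=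
    hf.diff_deriv.comp (differentiable_id.const_add d)
  split_ifs
  · exact differentiable_const 0
  · exact h d₀
  · exact h d₁
  · exact differentiable_const 0

lemma IsLink.hasDerivAt_pmfP (hf : IsLink f) (t : ℤ) (x : ℝ) :
    HasDerivAt (pmfP f d₀ d₁ t)
      (tailDeriv f d₀ d₁ t x - tailDeriv f d₀ d₁ (t + 1) x) x :=
  (hf.hasDerivAt_tailF t x).sub (hf.hasDerivAt_tailF (t + 1) x)

lemma IsLink.deriv_pmfP (hf : IsLink f) (t : ℤ) :
    deriv (pmfP f d₀ d₁ t) =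
      fun x => tailDeriv f d₀ d₁ t x - tailDeriv f d₀ d₁ (t + 1) x :=
  funext fun x => (hf.hasDerivAt_pmfP t x).deriv

lemma IsLink.differentiable_pmfP (hf : IsLink f) (t : ℤ) :
    Differentiable ℝ (pmfP f d₀ d₁ t) :=
  fun x => (hf.hasDerivAt_pmfP t x).differentiableAt

lemma IsLink.differentiable_deriv_pmfP (hf : IsLink f) (t : ℤ) :
    Differentiable ℝ (deriv (pmfP f d₀ d₁ t)) := by
  rw [hf.deriv_pmfP]
  exact (hf.differentiable_tailDeriv t).sub (hf.differentiable_tailDeriv (t + 1))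

lemma IsLink.pmfP_nonneg (hf : IsLink f) (hd : d₁ ≤ d₀) {t : ℤ} (ht : t ∈ edgeSupport) (x : ℝ) :
    0 ≤ pmfP f d₀ d₁ t x := by
  have h0 := hf.mem_unit (d₀ + x)
  have h1 := hf.mem_unit (d₁ + x)
  have h2 := hf.monotone (by linarith : d₁ + x ≤ d₀ + x)
  rcases ht with rfl | rfl | rfl <;> simp [pmfP, tailF] <;> linarith [h0.1, h0.2, h1.1, h1.2]

/-- The scores average to zero. -/
lemma IsLink.sum_deriv_pmfP (hf : IsLink f) (x : ℝ) :
    deriv (pmfP f d₀ d₁ (-1)) x + deriv (pmfP f d₀ d₁ 0) x + deriv (pmfP f d₀ d₁ 1) x = 0 := by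
  simp only [hf.deriv_pmfP]
  norm_num [tailDeriv]
  ring

lemma constH_le_of_pos {α : ℝ} (hH : 0 < constH f d₀ d₁ α) {t : ℤ} (ht : t ∈ edgeSupport) {x : ℝ}
    (hx : |x| ≤ α) :
    constH f d₀ d₁ α ≤ (deriv (pmfP f d₀ d₁ t) x) ^ 2 / (pmfP f d₀ d₁ t x) ^ 2
      - deriv (deriv (pmfP f d₀ d₁ t)) x / pmfP f d₀ d₁ t x := by
  refine csInf_le ?_ ⟨t, ht, x, hx, rfl⟩
  by_contra h
  rw [constH, Real.sInf_of_not_bddBelow h] at hH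
  exact lt_irrefl _ hH

/-- At a zero of `p` both quotients in the flatness expression take the value `0` of division by
zero, which contradicts `H > 0`. -/
lemma IsLink.pmfP_pos (hf : IsLink f) (hd : d₁ ≤ d₀) {α : ℝ} (hH : 0 < constH f d₀ d₁ α) {t : ℤ}
    (ht : t ∈ edgeSupport) {x : ℝ} (hx : |x| ≤ α) : 0 < pmfP f d₀ d₁ t x := by
  refine lt_of_le_of_ne (hf.pmfP_nonneg hd ht x) fun h => ?_
  have := constH_le_of_pos hH ht hx
  rw [← h] at this
  norm_num at this
  linarith

lemma steepness_le {α : ℝ} (hG : BddAbove (steepnessSet f d₀ d₁ α)) {t : ℤ} (ht : t ∈ edgeSupport)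
    {x : ℝ} (hx : |x| ≤ α) :
    |deriv (pmfP f d₀ d₁ t) x| / pmfP f d₀ d₁ t x ≤ constG f d₀ d₁ α :=
  le_csSup hG ⟨t, ht, x, hx, rfl⟩

/-- The score `p'(t | x) / p(t | x)`. -/
noncomputable def score (f : ℝ → ℝ) (d₀ d₁ : ℝ) (t : ℤ) (x : ℝ) : ℝ :=
  deriv (pmfP f d₀ d₁ t) x / pmfP f d₀ d₁ t x

lemma IsLink.abs_score_le (hf : IsLink f) (hd : d₁ ≤ d₀) {α : ℝ} (hH : 0 < constH f d₀ d₁ α)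
    (hG : BddAbove (steepnessSet f d₀ d₁ α)) {t : ℤ} (ht : t ∈ edgeSupport)
    {x : ℝ} (hx : |x| ≤ α) : |score f d₀ d₁ t x| ≤ constG f d₀ d₁ α := by
  rw [score, abs_div, abs_of_pos (hf.pmfP_pos hd hH ht hx)]
  exact steepness_le hG ht hx

lemma IsLink.hasDerivAt_log_pmfP (hf : IsLink f) (hd : d₁ ≤ d₀) {α : ℝ}
    (hH : 0 < constH f d₀ d₁ α) {t : ℤ} (ht : t ∈ edgeSupport) {x : ℝ} (hx : |x| ≤ α) :
    HasDerivAt (fun x => Real.log (pmfP f d₀ d₁ t x)) (score f d₀ d₁ t x) x :=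
  (hf.differentiable_pmfP t x).hasDerivAt.log (hf.pmfP_pos hd hH ht hx).ne'

lemma IsLink.hasDerivAt_score (hf : IsLink f) (hd : d₁ ≤ d₀) {α : ℝ}
    (hH : 0 < constH f d₀ d₁ α) {t : ℤ} (ht : t ∈ edgeSupport) {x : ℝ} (hx : |x| ≤ α) :
    HasDerivAt (score f d₀ d₁ t)
      (-((deriv (pmfP f d₀ d₁ t) x) ^ 2 / (pmfP f d₀ d₁ t x) ^ 2
      - deriv (deriv (pmfP f d₀ d₁ t)) x / pmfP f d₀ d₁ t x)) x := by
  have hp := (hf.pmfP_pos hd hH ht hx).ne'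
  refine ((hf.differentiable_deriv_pmfP (d₀ := d₀) (d₁ := d₁) t x).hasDerivAt.div
    (hf.differentiable_pmfP t x).hasDerivAt hp).congr_deriv ?_
  field_simp
  ring

lemma IsLink.score_add_antitoneOn (hf : IsLink f) (hd : d₁ ≤ d₀) {α : ℝ}
    (hH : 0 < constH f d₀ d₁ α) {t : ℤ} (ht : t ∈ edgeSupport) :
    AntitoneOn (fun x => score f d₀ d₁ t x + constH f d₀ d₁ α * x) (Set.Icc (-α) α) := by
  have key (x : ℝ) (hx : x ∈ Set.Icc (-α) α) :=
    (hf.hasDerivAt_score hd hH ht (abs_le.2 hx)).add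
      ((hasDerivAt_id x).const_mul (constH f d₀ d₁ α))
  refine antitoneOn_of_deriv_nonpos (convex_Icc _ _)
    (fun x hx => (key x hx).continuousAt.continuousWithinAt)
    (fun x hx => (key x (interior_subset hx)).differentiableAt.differentiableWithinAt) ?_
  intro x hx
  replace hx : x ∈ Set.Icc (-α) α := interior_subset hx
  have h1 := (key x hx).deriv
  have h2 := constH_le_of_pos hH ht (abs_le.2 hx)
  refine h1.trans_le ?_
  linarith

/-- Strong concavity of the log-likelihood of a single edge. -/
lemma IsLink.log_pmfP_sub_le (hf : IsLink f) (hd : d₁ ≤ d₀) {α : ℝ}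
    (hH : 0 < constH f d₀ d₁ α) {t : ℤ} (ht : t ∈ edgeSupport) {x y : ℝ} (hx : |x| ≤ α)
    (hy : |y| ≤ α) :
    Real.log (pmfP f d₀ d₁ t x) - Real.log (pmfP f d₀ d₁ t y) ≤
      score f d₀ d₁ t y * (x - y) - constH f d₀ d₁ α / 2 * (x - y) ^ 2 := by
  set H := constH f d₀ d₁ α
  -- Log-likelihood minus its linear part at `y`, plus the quadratic. By the antitonicity of score
  -- plus `H z`, the derivative is nonnegative left of `y` and nonpositive right of it, so `φ` is
  -- maximal at `y`.
  set φ : ℝ → ℝ := fun x => Real.log (pmfP f d₀ d₁ t x)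
    - score f d₀ d₁ t y * x + H / 2 * (x - y) ^ 2 with hφ
  have key : ∀ z ∈ Set.Icc (-α) α, HasDerivAt φ
      ((score f d₀ d₁ t z + H * z) - (score f d₀ d₁ t y + H * y)) z := by
    intro z hz
    refine (((hf.hasDerivAt_log_pmfP hd hH ht (abs_le.2 hz)).sub
      ((hasDerivAt_id z).const_mul (score f d₀ d₁ t y))).add
      ((((hasDerivAt_id z).sub_const y).pow 2).const_mul (H / 2))).congr_deriv ?_
    simp only [id]
    push_cast
    ring
  have hanti := hf.score_add_antitoneOn hd hH ht
  rw [abs_le] at hx hy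
  have main : φ x ≤ φ y := by
    rcases lt_trichotomy x y with h | rfl | h
    · obtain ⟨c, hc, hc'⟩ := exists_hasDerivAt_eq_slope φ _ h
        (fun z hz => (key z ⟨hx.1.trans hz.1, hz.2.trans hy.2⟩).continuousAt.continuousWithinAt)
        (fun z hz => key z ⟨hx.1.trans hz.1.le, hz.2.le.trans hy.2⟩)
      have h1 := hanti ⟨hx.1.trans hc.1.le, hc.2.le.trans hy.2⟩ hy hc.2.le
      rw [eq_div_iff (by linarith)] at hc'
      simp only at h1
      nlinarith [mul_nonneg (sub_nonneg.2 h1) (sub_nonneg.2 h.le)]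
    · exact le_rfl
    · obtain ⟨c, hc, hc'⟩ := exists_hasDerivAt_eq_slope φ _ h
        (fun z hz => (key z ⟨hy.1.trans hz.1, hz.2.trans hx.2⟩).continuousAt.continuousWithinAt)
        (fun z hz => key z ⟨hy.1.trans hz.1.le, hz.2.le.trans hx.2⟩)
      have h1 := hanti hy ⟨hy.1.trans hc.1.le, hc.2.le.trans hx.2⟩ hc.1.le
      rw [eq_div_iff (by linarith)] at hc'
      simp only at h1
      nlinarith [mul_nonneg (sub_nonneg.2 h1) (sub_nonneg.2 h.le)]
  simp only [hφ, sub_self] at main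
  nlinarith

/-- Otherwise the score of the value `0` vanishes on the whole interval, and adding `H x` to it
would not give an antitone function. -/
lemma IsLink.constG_pos (hf : IsLink f) (hd : d₁ ≤ d₀) {α : ℝ} (hα : 0 < α)
    (hH : 0 < constH f d₀ d₁ α) (hG : BddAbove (steepnessSet f d₀ d₁ α)) :
    0 < constG f d₀ d₁ α := by
  by_contra hG0
  have h0 : (0 : ℤ) ∈ edgeSupport := by simp [edgeSupport]
  have hs : ∀ x, |x| ≤ α → score f d₀ d₁ 0 x = 0 := fun x hx => by
    have := hf.abs_score_le hd hH hG h0 hx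
    exact abs_eq_zero.1 (le_antisymm (by linarith) (abs_nonneg _))
  have := hf.score_add_antitoneOn hd hH h0 (a := 0) (b := α) ⟨by linarith, hα.le⟩
    ⟨by linarith, le_rfl⟩ hα.le
  simp only [hs 0 (by simpa using hα.le), hs α (abs_of_pos hα).le] at this
  nlinarith [mul_pos hH hα]

lemma radius_pos {C : ℝ} (hC : 0 < C) (d₀ : ℝ) : 0 < radius C d₀ := by
  have := le_max_right d₀ 0
  unfold radius
  positivity

/-- The squared distance contributes at most `4 C²` and the inner product at most `C²`; feasible
parameters thus stay where `G` and `H` control the likelihood. -/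
lemma abs_paramM_le {n K₁ K₂ : ℕ} {B : Emb n K₁} {A : Emb n K₂} {C : ℝ} (d₀ : ℝ)
    (hB : ∀ i, ‖B i‖ ≤ C) (hA : ∀ i, ‖A i‖ ≤ C) (i j : Fin n) :
    |paramM B A i j| ≤ radius C d₀ := by
  have h1 : ‖B i - B j‖ ≤ 2 * C := (norm_sub_le _ _).trans (by linarith [hB i, hB j])
  have h2 : ‖B i - B j‖ ^ 2 ≤ (2 * C) ^ 2 := pow_le_pow_left₀ (norm_nonneg _) h1 2
  have h3 : |inner ℝ (A i) (A j)| ≤ C * C := (abs_real_inner_le_norm _ _).trans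
    (mul_le_mul (hA i) (hA j) (norm_nonneg _) ((norm_nonneg _).trans (hA i)))
  have h4 := le_max_right d₀ 0
  rw [abs_le] at h3
  unfold paramM radius
  rw [abs_le]
  constructor <;> nlinarith [sq_nonneg ‖B i - B j‖]

end Link

/-! ### Matrix norms and perturbation of the factor `B` -/

section Perturbation

open scoped Matrix Matrix.Norms.L2Operator

variable {l m n : Type*} [Fintype l] [Fintype m] [Fintype n]

/-- The Frobenius norm of a matrix. -/
noncomputable def frob (X : Matrix m n ℝ) : ℝ :=
  ‖(WithLp.toLp 2 fun p : m × n => X p.1 p.2 : EuclideanSpace ℝ (m × n))‖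

lemma frob_nonneg (X : Matrix m n ℝ) : 0 ≤ frob X := norm_nonneg _

lemma frob_sq (X : Matrix m n ℝ) : frob X ^ 2 = ∑ i, ∑ j, X i j ^ 2 := by
  simp [frob, EuclideanSpace.norm_sq_eq, Fintype.sum_prod_type]

lemma frob_smul (c : ℝ) (X : Matrix m n ℝ) : frob (c • X) = |c| * frob X :=
  norm_smul c (WithLp.toLp 2 fun p : m × n => X p.1 p.2 : EuclideanSpace ℝ (m × n))

lemma frob_neg (X : Matrix m n ℝ) : frob (-X) = frob X :=
  norm_neg (WithLp.toLp 2 fun p : m × n => X p.1 p.2 : EuclideanSpace ℝ (m × n))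

lemma frob_zero : frob (0 : Matrix m n ℝ) = 0 := by
  simpa using frob_smul 0 (0 : Matrix m n ℝ)

lemma frob_sub_le (X Y : Matrix m n ℝ) : frob (X - Y) ≤ frob X + frob Y :=
  norm_sub_le (WithLp.toLp 2 fun p : m × n => X p.1 p.2 : EuclideanSpace ℝ (m × n))
    (WithLp.toLp 2 fun p : m × n => Y p.1 p.2)

lemma frob_transpose (X : Matrix m n ℝ) : frob Xᵀ = frob X := by
  rw [← sq_eq_sq₀ (frob_nonneg _) (frob_nonneg _), frob_sq, frob_sq, Finset.sum_comm]
  rfl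

lemma opNorm_le_of_forall [DecidableEq n] (X : Matrix m n ℝ) {c : ℝ} (hc : 0 ≤ c)
    (h : ∀ v : n → ℝ, ‖WithLp.toLp 2 (X *ᵥ v)‖ ≤ c * ‖WithLp.toLp 2 v‖) : ‖X‖ ≤ c := by
  rw [Matrix.l2_opNorm_def]
  exact ContinuousLinearMap.opNorm_le_bound _ hc fun v => h v.ofLp

lemma norm_mulVec_le [DecidableEq n] (X : Matrix m n ℝ) (v : n → ℝ) :
    ‖WithLp.toLp 2 (X *ᵥ v)‖ ≤ ‖X‖ * ‖WithLp.toLp 2 v‖ :=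
  Matrix.l2_opNorm_mulVec X (WithLp.toLp 2 v)

lemma norm_transpose [DecidableEq m] [DecidableEq n] (X : Matrix m n ℝ) : ‖Xᵀ‖ = ‖X‖ := by
  rw [← Matrix.l2_opNorm_conjTranspose X, Matrix.conjTranspose_eq_transpose_of_trivial]

lemma norm_transpose_mul_self [DecidableEq n] (X : Matrix m n ℝ) : ‖Xᵀ * X‖ = ‖X‖ ^ 2 := by
  rw [← Matrix.conjTranspose_eq_transpose_of_trivial, Matrix.l2_opNorm_conjTranspose_mul_self, sq]

lemma norm_mul_transpose_self [DecidableEq m] [DecidableEq n] (X : Matrix m n ℝ) :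
    ‖X * Xᵀ‖ = ‖X‖ ^ 2 := by
  simpa [norm_transpose] using norm_transpose_mul_self Xᵀ

lemma frob_mul_le_left [DecidableEq m] (X : Matrix l m ℝ) (Y : Matrix m n ℝ) :
    frob (X * Y) ≤ ‖X‖ * frob Y := by
  refine abs_le_of_sq_le_sq' ?_ (mul_nonneg (norm_nonneg _) (frob_nonneg _)) |>.2
  rw [mul_pow, ← frob_transpose, ← frob_transpose Y, frob_sq, frob_sq, Finset.mul_sum]
  refine Finset.sum_le_sum fun k _ => ?_
  have h := pow_le_pow_left₀ (norm_nonneg _) (norm_mulVec_le X (Yᵀ k)) 2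
  rw [mul_pow, EuclideanSpace.norm_sq_eq, EuclideanSpace.norm_sq_eq] at h
  simpa [Matrix.mulVec, Matrix.mul_apply, dotProduct] using h

lemma frob_mul_le_right [DecidableEq m] [DecidableEq n] (X : Matrix l m ℝ) (Y : Matrix m n ℝ) :
    frob (X * Y) ≤ frob X * ‖Y‖ := by
  rw [← frob_transpose, Matrix.transpose_mul, ← frob_transpose X, ← norm_transpose Y, mul_comm]
  exact frob_mul_le_left _ _

lemma opNorm_le_frob [DecidableEq n] (X : Matrix m n ℝ) : ‖X‖ ≤ frob X := by
  refine opNorm_le_of_forall X (frob_nonneg X) fun v => ?_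
  refine abs_le_of_sq_le_sq' ?_ (mul_nonneg (frob_nonneg _) (norm_nonneg _)) |>.2
  rw [mul_pow, frob_sq, EuclideanSpace.norm_sq_eq, EuclideanSpace.norm_sq_eq, Finset.sum_mul]
  refine Finset.sum_le_sum fun i _ => ?_
  simpa [Matrix.mulVec, dotProduct] using
    Finset.sum_mul_sq_le_sq_mul_sq Finset.univ (X i) v

lemma exists_inverse_of_lower_bound [DecidableEq n] (T : Matrix n n ℝ) {c : ℝ} (hc : 0 < c)
    (h : ∀ v : n → ℝ, c * ‖WithLp.toLp 2 v‖ ≤ ‖WithLp.toLp 2 (T *ᵥ v)‖) :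
    ∃ T' : Matrix n n ℝ, T * T' = 1 ∧ T' * T = 1 ∧ ‖T'‖ ≤ 1 / c := by
  have hinj : Function.Injective T.mulVec := by
    intro v w hvw
    have h1 := h (v - w)
    simp only [Matrix.mulVec_sub, hvw, sub_self, WithLp.toLp_zero, norm_zero] at h1
    have h2 : ‖WithLp.toLp 2 (v - w)‖ = 0 :=
      le_antisymm (le_of_mul_le_mul_left (by simpa using h1) hc) (norm_nonneg _)
    rw [norm_eq_zero, WithLp.toLp_eq_zero, sub_eq_zero] at h2
    exact h2
  have hu : IsUnit T.det := (Matrix.isUnit_iff_isUnit_det T).1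
    (Matrix.mulVec_injective_iff_isUnit.1 hinj)
  refine ⟨T⁻¹, Matrix.mul_nonsing_inv T hu, Matrix.nonsing_inv_mul T hu, ?_⟩
  refine opNorm_le_of_forall _ (by positivity) fun v => ?_
  have h1 := h (T⁻¹ *ᵥ v)
  rw [Matrix.mulVec_mulVec, Matrix.mul_nonsing_inv T hu, Matrix.one_mulVec] at h1
  rw [one_div, inv_mul_eq_div, le_div_iff₀ hc]
  linarith

lemma norm_mulVec_sq (X : Matrix m n ℝ) (v : n → ℝ) :
    ‖WithLp.toLp 2 (X *ᵥ v)‖ ^ 2 = v ⬝ᵥ ((Xᵀ * X) *ᵥ v) := by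
  rw [EuclideanSpace.norm_sq_eq, ← Matrix.mulVec_mulVec, Matrix.dotProduct_mulVec,
    Matrix.vecMul_transpose]
  simp [dotProduct, sq]

lemma abs_dotProduct_le (v w : n → ℝ) :
    |v ⬝ᵥ w| ≤ ‖WithLp.toLp 2 v‖ * ‖WithLp.toLp 2 w‖ := by
  have := abs_real_inner_le_norm (WithLp.toLp 2 v : EuclideanSpace ℝ n) (WithLp.toLp 2 w)
  simpa [PiLp.inner_apply, dotProduct, mul_comm] using this

set_option maxHeartbeats 1000000 in
/-- A perturbation bound for the factor `B` of `2 B Bᵀ + A Aᵀ` when `Bᵀ A = 0` and `A` is small: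
up to an invertible linear map, `B` is recovered at the rate of the error. -/
theorem exists_alignment {k₁ k₂ : Type*} [Fintype k₁] [Fintype k₂] [DecidableEq k₁]
    [DecidableEq k₂] [DecidableEq n]
    (B B' : Matrix n k₁ ℝ) (A A' : Matrix n k₂ ℝ) {N lam Lam η : ℝ}
    (hN : 0 < N) (hlam : 0 < lam) (hLam : lam ≤ Lam) (hη1 : η ≤ lam / 2)
    (hη2 : 64 * Lam * η ^ 2 ≤ lam ^ 3)
    (hBA : Bᵀ * A = 0) (hBA' : B'ᵀ * A' = 0)
    (hlow : ∀ v : k₁ → ℝ, lam / 2 * N * ‖WithLp.toLp 2 v‖ ^ 2 ≤ ‖WithLp.toLp 2 (B *ᵥ v)‖ ^ 2)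
    (hB : ‖B‖ ^ 2 ≤ 2 * Lam * N) (hA : ‖A‖ ^ 2 ≤ η * N) (hA' : ‖A'‖ ^ 2 ≤ η * N)
    {e : ℝ} (he : frob (2 • (B' * B'ᵀ - B * Bᵀ) + (A' * A'ᵀ - A * Aᵀ)) ≤ e) (heη : e ≤ η * N) :
    ∃ Q : Matrix k₁ k₁ ℝ, frob (B' - B * Q) ^ 2 ≤ 256 * Lam ^ 2 / lam ^ 3 * e ^ 2 / N ∧
      ∀ v : k₁ → ℝ, lam / (6 * Lam) * ‖WithLp.toLp 2 v‖ ≤ ‖WithLp.toLp 2 (Qᵀ *ᵥ v)‖ := by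
  have hLam0 : 0 < Lam := hlam.trans_le hLam
  set E := 2 • (B' * B'ᵀ - B * Bᵀ) + (A' * A'ᵀ - A * Aᵀ) with hE
  have he0 : 0 ≤ e := (frob_nonneg _).trans he
  have hAB : Aᵀ * B = 0 := by
    rw [← Matrix.transpose_transpose B, ← Matrix.transpose_mul, hBA, Matrix.transpose_zero]
  have hAB' : A'ᵀ * B' = 0 := by
    rw [← Matrix.transpose_transpose B', ← Matrix.transpose_mul, hBA', Matrix.transpose_zero]
  -- the inverse of the Gram matrix
  obtain ⟨Si, hS1, -, hSi⟩ : ∃ Si : Matrix k₁ k₁ ℝ, (Bᵀ * B) * Si = 1 ∧ Si * (Bᵀ * B) = 1 ∧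
      ‖Si‖ ≤ 1 / (lam / 2 * N) := by
    refine exists_inverse_of_lower_bound _ (by positivity) fun v => ?_
    rcases eq_or_ne v 0 with rfl | hv
    · simp
    have hv0 : 0 < ‖WithLp.toLp 2 v‖ := norm_pos_iff.2 (by simpa using hv)
    have h1 := (hlow v).trans ((norm_mulVec_sq B v).le.trans
      ((le_abs_self _).trans (abs_dotProduct_le _ _)))
    refine le_of_mul_le_mul_left ?_ hv0
    linarith
  have hEB : E * B = 2 • (B' * (B'ᵀ * B)) - 2 • (B * (Bᵀ * B)) + A' * (A'ᵀ * B) := by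
    simp only [hE, Matrix.add_mul, Matrix.sub_mul, Matrix.smul_mul, Matrix.mul_assoc, hAB,
      Matrix.mul_zero, sub_zero, smul_sub]
  -- Multiplying by `A'ᵀ` kills the `B'` term and leaves a Sylvester equation for the overlap `A'ᵀ
  -- B`. It is solved by absorption, because `‖A'‖²` is at most `lam / 2 * N`, the lower bound for
  -- `Bᵀ B`.
  have hAEB : A'ᵀ * (E * B) = (A'ᵀ * A') * (A'ᵀ * B) - 2 • ((A'ᵀ * B) * (Bᵀ * B)) := by
    rw [hEB]
    simp only [Matrix.mul_add, Matrix.mul_sub, Matrix.mul_smul, ← Matrix.mul_assoc, hAB',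
      Matrix.zero_mul, smul_zero, zero_sub]
    abel
  set b := ‖B‖ with hb
  have hb0 : 0 ≤ b := norm_nonneg _
  set α := ‖A'‖ with hα
  have hα0 : 0 ≤ α := norm_nonneg _
  have hfEB : frob (E * B) ≤ e * b :=
    (frob_mul_le_right _ _).trans (mul_le_mul_of_nonneg_right he hb0)
  have hlN : 0 < lam * N := by positivity
  have hSi' : ‖Si‖ ≤ 2 / (lam * N) := hSi.trans_eq (by field_simp)
  -- the overlap between `A'` and `B` is small
  have h2 : frob (A'ᵀ * B) * (lam * N) ≤ 2 * (α * (e * b)) := by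
    have h3 : 2 • (A'ᵀ * B) = ((A'ᵀ * A') * (A'ᵀ * B) - A'ᵀ * (E * B)) * Si := by
      rw [hAEB, sub_sub_cancel, Matrix.smul_mul, Matrix.mul_assoc _ _ Si, hS1, Matrix.mul_one]
    have h4 : 2 * frob (A'ᵀ * B) ≤ (α ^ 2 * frob (A'ᵀ * B) + α * (e * b)) * (2 / (lam * N)) := by
      have h5 : frob (2 • (A'ᵀ * B)) = 2 * frob (A'ᵀ * B) := by
        rw [← Nat.cast_smul_eq_nsmul ℝ, frob_smul]; norm_num
      rw [← h5, h3]
      refine (frob_mul_le_right _ _).trans (mul_le_mul ?_ hSi' (norm_nonneg _) (by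
        have := frob_nonneg (A'ᵀ * B); positivity))
      refine (frob_sub_le _ _).trans (add_le_add ?_ ?_)
      · refine (frob_mul_le_left _ _).trans_eq ?_
        rw [norm_transpose_mul_self]
      · refine (frob_mul_le_left _ _).trans ?_
        rw [norm_transpose]
        exact mul_le_mul_of_nonneg_left hfEB hα0
    rw [mul_div_assoc', le_div_iff₀ hlN] at h4
    have h6 : α ^ 2 ≤ lam / 2 * N := hA'.trans (mul_le_mul_of_nonneg_right hη1 hN.le)
    have h7 := mul_le_mul_of_nonneg_right h6 (frob_nonneg (A'ᵀ * B))
    linarith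
  -- Multiplying the formula for `E * B` by the inverse Gram matrix and solving for `B` gives `B =
  -- B' R` up to terms in `E` and the overlap.
  set R := B'ᵀ * B * Si with hR
  have hBR : 2 • (B - B' * R) = (A' * (A'ᵀ * B) - E * B) * Si := by
    have hS2 : Bᵀ * (B * Si) = 1 := by rw [← Matrix.mul_assoc, hS1]
    rw [hEB, hR]
    simp only [Matrix.sub_mul, Matrix.add_mul, Matrix.smul_mul, Matrix.mul_assoc,
      hS2, Matrix.mul_one, smul_sub]
    abel
  have hfBR : frob (B - B' * R) * (lam * N) ≤ 2 * (e * b) := by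
    have h5 : 2 * frob (B - B' * R) ≤ (α * frob (A'ᵀ * B) + e * b) * (2 / (lam * N)) := by
      have h5 : frob (2 • (B - B' * R)) = 2 * frob (B - B' * R) := by
        rw [← Nat.cast_smul_eq_nsmul ℝ, frob_smul]; norm_num
      rw [← h5, hBR]
      refine (frob_mul_le_right _ _).trans (mul_le_mul ?_ hSi' (norm_nonneg _) (by
        have := frob_nonneg (A'ᵀ * B); positivity))
      exact (frob_sub_le _ _).trans (add_le_add (frob_mul_le_left _ _) hfEB)
    rw [mul_div_assoc', le_div_iff₀ hlN] at h5
    have h6 : α ^ 2 ≤ lam / 2 * N := hA'.trans (mul_le_mul_of_nonneg_right hη1 hN.le)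
    have h7 : α * frob (A'ᵀ * B) ≤ e * b := by
      refine le_of_mul_le_mul_right ?_ hlN
      have h8 := mul_le_mul_of_nonneg_left h2 hα0
      have h9 := mul_le_mul_of_nonneg_right h6 (mul_nonneg he0 hb0)
      nlinarith
    linarith
  -- bounds for `B'` and for `R`
  have hB' : ‖B'‖ ^ 2 ≤ 4 * Lam * N := by
    have h3 : 2 • (B' * B'ᵀ) = E + 2 • (B * Bᵀ) + A * Aᵀ - A' * A'ᵀ := by
      rw [hE, smul_sub]; abel
    have h4 : ‖2 • (B' * B'ᵀ)‖ = 2 * ‖B'‖ ^ 2 := by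
      rw [← Nat.cast_smul_eq_nsmul ℝ, norm_smul, norm_mul_transpose_self]; norm_num
    have h5 : ‖2 • (B * Bᵀ)‖ = 2 * b ^ 2 := by
      rw [← Nat.cast_smul_eq_nsmul ℝ, norm_smul, norm_mul_transpose_self, ← hb]; norm_num
    have h6 : ‖E‖ ≤ η * N := (opNorm_le_frob E).trans (he.trans heη)
    have h7 : ‖E + 2 • (B * Bᵀ) + A * Aᵀ - A' * A'ᵀ‖ ≤
        ‖E‖ + ‖2 • (B * Bᵀ)‖ + ‖A * Aᵀ‖ + ‖A' * A'ᵀ‖ :=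
      (norm_sub_le _ _).trans (add_le_add_left ((norm_add_le _ _).trans
        (add_le_add_left (norm_add_le _ _) _)) _)
    rw [← h3, h4, h5, norm_mul_transpose_self, norm_mul_transpose_self] at h7
    have h8 : η * N ≤ Lam / 2 * N := mul_le_mul_of_nonneg_right (by linarith) hN.le
    nlinarith
  set b' := ‖B'‖ with hb'
  have hb'0 : 0 ≤ b' := norm_nonneg _
  have hRn : ‖R‖ ≤ 6 * Lam / lam := by
    have h3 : ‖R‖ ≤ b' * b * (2 / (lam * N)) := by
      refine (Matrix.l2_opNorm_mul _ _).trans (mul_le_mul ?_ hSi' (norm_nonneg _) (by positivity))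
      refine (Matrix.l2_opNorm_mul _ _).trans_eq ?_
      rw [norm_transpose]
    have h4 : b' * b ≤ 3 * Lam * N := by
      refine abs_le_of_sq_le_sq' ?_ (by positivity) |>.2
      rw [mul_pow]
      refine (mul_le_mul hB' hB (by positivity) (by positivity)).trans ?_
      nlinarith [sq_nonneg (Lam * N)]
    refine h3.trans ((mul_le_mul_of_nonneg_right h4 (by positivity)).trans_eq ?_)
    field_simp
    norm_num
  -- `B v` is bounded below by `t s`, while the residual `B - B' R` costs at most half of that, by
  -- the smallness of `η`. So `r ≥ t s / (2 ‖B'‖)`, and `t² = lam N / 2`, `‖B'‖² ≤ 4 Lam N` give the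
  -- constant.
  have hRlow : ∀ v : k₁ → ℝ, √(lam / Lam / 32) * ‖WithLp.toLp 2 v‖ ≤ ‖WithLp.toLp 2 (R *ᵥ v)‖ := by
    intro v
    set s := ‖WithLp.toLp 2 v‖ with hs
    have hs0 : 0 ≤ s := norm_nonneg _
    set r := ‖WithLp.toLp 2 (R *ᵥ v)‖ with hr
    have hr0 : 0 ≤ r := norm_nonneg _
    have h3 : ‖WithLp.toLp 2 (B *ᵥ v)‖ ≤ b' * r + frob (B - B' * R) * s := by
      have h4 : B *ᵥ v = B' *ᵥ (R *ᵥ v) + (B - B' * R) *ᵥ v := by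
        rw [Matrix.sub_mulVec, Matrix.mulVec_mulVec]; abel
      rw [h4, WithLp.toLp_add]
      refine (norm_add_le _ _).trans (add_le_add (norm_mulVec_le _ _) ?_)
      exact (norm_mulVec_le _ _).trans (mul_le_mul_of_nonneg_right (opNorm_le_frob _) hs0)
    -- all quantities are compared with `t = √(λ N / 2)`
    have ht0 : 0 < lam / 2 * N := by positivity
    set t := √(lam / 2 * N) with ht
    have htp : 0 < t := Real.sqrt_pos.2 ht0
    have htsq : t ^ 2 = lam / 2 * N := Real.sq_sqrt ht0.le
    have h4 : t * s ≤ ‖WithLp.toLp 2 (B *ᵥ v)‖ := by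
      refine abs_le_of_sq_le_sq' ?_ (norm_nonneg _) |>.2
      rw [mul_pow, htsq]
      exact hlow v
    have h5 : frob (B - B' * R) ≤ t / 2 := by
      refine le_of_mul_le_mul_right (hfBR.trans ?_) hlN
      refine abs_le_of_sq_le_sq' ?_ (by positivity) |>.2
      have : (t / 2 * (lam * N)) ^ 2 = lam ^ 3 / 8 * N ^ 3 := by
        rw [mul_pow, div_pow, htsq]; ring
      rw [this]
      have h6 : e ^ 2 ≤ (η * N) ^ 2 := pow_le_pow_left₀ he0 heη 2
      calc (2 * (e * b)) ^ 2 = 4 * (e ^ 2 * b ^ 2) := by ring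
        _ ≤ 4 * ((η * N) ^ 2 * (2 * Lam * N)) := by gcongr
        _ = 64 * Lam * η ^ 2 / 8 * N ^ 3 := by ring
        _ ≤ _ := by gcongr
    have h6 : t / 2 * s ≤ b' * r := by nlinarith
    refine abs_le_of_sq_le_sq' ?_ hr0 |>.2
    rw [mul_pow, Real.sq_sqrt (by positivity)]
    have h7 : (t / 2 * s) ^ 2 ≤ (b' * r) ^ 2 := pow_le_pow_left₀ (by positivity) h6 2
    rw [mul_pow, div_pow, htsq, mul_pow] at h7
    have h8 := mul_le_mul_of_nonneg_right hB' (sq_nonneg r)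
    have h9 : lam / Lam / 32 * s ^ 2 = (lam / 2 * N / 2 ^ 2 * s ^ 2) / (4 * Lam * N) := by
      field_simp; ring
    rw [h9, div_le_iff₀ (by positivity)]
    linarith
  -- With `Q` the inverse of `R`, the lower bound for `R` controls `B' - B Q`, and the upper bound
  -- for `R` becomes the lower bound for `Qᵀ`.
  obtain ⟨Q, hRQ, -, hQ⟩ := exists_inverse_of_lower_bound R (by positivity) hRlow
  refine ⟨Q, ?_, fun v => ?_⟩
  · have h3 : B' - B * Q = -((B - B' * R) * Q) := by
      rw [Matrix.sub_mul, Matrix.mul_assoc, hRQ, Matrix.mul_one]; abel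
    have h4 : frob (B' - B * Q) ≤ 2 * (e * b) / (lam * N) * (1 / √(lam / Lam / 32)) := by
      rw [h3, frob_neg]
      refine (frob_mul_le_right _ _).trans (mul_le_mul ?_ hQ (norm_nonneg _) (by positivity))
      rwa [le_div_iff₀ hlN]
    refine (pow_le_pow_left₀ (frob_nonneg _) h4 2).trans ?_
    rw [mul_pow, div_pow, div_pow, Real.sq_sqrt (by positivity)]
    calc (2 * (e * b)) ^ 2 / (lam * N) ^ 2 * (1 ^ 2 / (lam / Lam / 32))
        = 128 * Lam / lam ^ 3 * e ^ 2 * b ^ 2 / N ^ 2 := by field_simp; ring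
      _ ≤ 128 * Lam / lam ^ 3 * e ^ 2 * (2 * Lam * N) / N ^ 2 := by gcongr
      _ = _ := by field_simp; ring
  · have h3 : v = Rᵀ *ᵥ (Qᵀ *ᵥ v) := by
      rw [Matrix.mulVec_mulVec, ← Matrix.transpose_mul, mul_eq_one_comm.1 hRQ,
        Matrix.transpose_one, Matrix.one_mulVec]
    have h4 : ‖WithLp.toLp 2 v‖ ≤ 6 * Lam / lam * ‖WithLp.toLp 2 (Qᵀ *ᵥ v)‖ := by
      conv_lhs => rw [h3]
      refine (norm_mulVec_le _ _).trans (mul_le_mul_of_nonneg_right ?_ (norm_nonneg _))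
      rwa [norm_transpose]
    calc _ ≤ lam / (6 * Lam) * (6 * Lam / lam * ‖WithLp.toLp 2 (Qᵀ *ᵥ v)‖) := by gcongr
      _ = _ := by field_simp

end Perturbation

/-! ### Approximate K-means and the error measures -/

section KMeans

variable {n m K : ℕ}

/-- Approximate `K`-means recovers well separated communities up to an exceptional set whose size
is controlled by the cost of the true assignment. -/
theorem IsApproxKMeans.exists_perm {X : Emb n K} {ψ ψhat : Fin n → Fin m} {z : Emb m K}
    {ε δ e : ℝ} (hε : 0 ≤ ε) (hδ : 0 < δ) (hsep : ∀ l k, l ≠ k → δ ≤ ‖z l - z k‖)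
    (hcost : kmeansCost X ψ z ≤ e) (h : IsApproxKMeans ε X ψhat)
    (hsize : ∀ l, 8 * (2 + ε) * e / δ ^ 2 < (community ψ l).card) :
    ∃ p : Equiv.Perm (Fin m), ∃ S : Finset (Fin n), (S.card : ℝ) ≤ 8 * (2 + ε) * e / δ ^ 2 ∧
      ∀ l, community ψ l \ community ψhat (p l) ⊆ S := by
  obtain ⟨x, hx⟩ := h
  set d : Fin n → ℝ := fun i => ‖x (ψhat i) - z (ψ i)‖ with hd
  -- The fitted cost is at most `(1 + ε) e` and the true assignment costs at most `e`; the factor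
  -- `2` is from squaring the triangle inequality.
  have hsum : ∑ i, d i ^ 2 ≤ 2 * (2 + ε) * e := by
    have h1 : ∀ i, d i ^ 2 ≤ 2 * (‖X i - x (ψhat i)‖ ^ 2 + ‖X i - z (ψ i)‖ ^ 2) := fun i => by
      have h2 : d i ≤ ‖X i - x (ψhat i)‖ + ‖X i - z (ψ i)‖ := by
        have := norm_sub_le (X i - z (ψ i)) (X i - x (ψhat i))
        rw [sub_sub_sub_cancel_left] at this
        linarith
      nlinarith [norm_nonneg (x (ψhat i) - z (ψ i)),
        sq_nonneg (‖X i - x (ψhat i)‖ - ‖X i - z (ψ i)‖)]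
    refine (Finset.sum_le_sum fun i _ => h1 i).trans ?_
    rw [← Finset.mul_sum, Finset.sum_add_distrib]
    have h2 := hx ψ z
    have h3 := mul_le_mul_of_nonneg_left hcost (by linarith : 0 ≤ 1 + ε)
    unfold kmeansCost at h2 h3 hcost
    linarith
  -- Markov's inequality bounds the size of `S`. Two nodes outside `S` with one fitted centre have
  -- true centres closer than `δ`, hence equal labels.
  set S := Finset.univ.filter fun i => δ / 2 ≤ d i with hS
  have hScard : (S.card : ℝ) ≤ 8 * (2 + ε) * e / δ ^ 2 := by
    rw [le_div_iff₀ (by positivity)]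
    have h1 : (S.card : ℝ) * (δ / 2) ^ 2 ≤ ∑ i, d i ^ 2 := by
      rw [← nsmul_eq_mul]
      refine (Finset.card_nsmul_le_sum S (fun i => d i ^ 2) _ fun i hi => ?_).trans
        (Finset.sum_le_univ_sum_of_nonneg fun i => sq_nonneg _)
      exact pow_le_pow_left₀ (by positivity) (Finset.mem_filter.1 hi).2 2
    nlinarith
  have hgood : ∀ i j, i ∉ S → j ∉ S → ψhat i = ψhat j → ψ i = ψ j := by
    intro i j hi hj hij
    by_contra hne
    simp only [hS, Finset.mem_filter, Finset.mem_univ, true_and, not_le, hd] at hi hj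
    have h1 := hsep _ _ hne
    have h2 := norm_sub_le (x (ψhat i) - z (ψ j)) (x (ψhat i) - z (ψ i))
    rw [sub_sub_sub_cancel_left] at h2
    rw [← hij] at hj
    linarith
  -- `S` is too small to contain a community. The fitted labels of representatives outside `S` are
  -- then distinct, so they define a permutation of the `m` labels.
  have hex : ∀ l, ∃ i, ψ i = l ∧ i ∉ S := by
    intro l
    by_contra! hcon
    have h1 : community ψ l ⊆ S := fun i hi => hcon i (Finset.mem_filter.1 hi).2
    have h2 : ((community ψ l).card : ℝ) ≤ S.card := by exact_mod_cast Finset.card_le_card h1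
    linarith [hsize l]
  choose g hg hgS using hex
  have hinj : Function.Injective fun l => ψhat (g l) := fun l k hlk => by
    rw [← hg l, ← hg k]
    exact hgood _ _ (hgS l) (hgS k) hlk
  let p : Equiv.Perm (Fin m) := Equiv.ofBijective _ (Finite.injective_iff_bijective.1 hinj)
  refine ⟨p, S, hScard, fun l i hi => ?_⟩
  by_contra hiS
  simp only [community, Finset.mem_sdiff, Finset.mem_filter, Finset.mem_univ, true_and] at hi
  obtain ⟨k, hk⟩ := p.surjective (ψhat i)
  have hkl : ψ i = k := (hgood _ _ hiS (hgS k) hk.symm).trans (hg k)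
  exact hi.2 (by rw [← hk, ← hkl, hi.1])

lemma minProportion_mul_le (ψ : Fin n → Fin m) (l : Fin m) :
    minProportion ψ * n ≤ (community ψ l).card := by
  rcases Nat.eq_zero_or_pos n with rfl | hn
  · simp
  have hn' : (0 : ℝ) < n := by exact_mod_cast hn
  rw [← le_div_iff₀ hn']
  exact ciInf_le (Set.finite_range _).bddBelow l

lemma minSeparation_le (b : Emb m K) {l k : Fin m} (h : l ≠ k) :
    minSeparation b ≤ ‖b l - b k‖ := by
  rcases lt_or_gt_of_ne h with h | h
  · exact ciInf_le (Set.finite_range _).bddBelow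
      (⟨(l, k), h⟩ : {q : Fin m × Fin m // q.1 < q.2})
  · rw [norm_sub_rev]
    exact ciInf_le (Set.finite_range _).bddBelow
      (⟨(k, l), h⟩ : {q : Fin m × Fin m // q.1 < q.2})

/-- Communities are disjoint, so the misclustered nodes of all of them together number at most
`S.card`, with no factor `m`. -/
lemma overallError_le {ψ ψhat : Fin n → Fin m} {p : Equiv.Perm (Fin m)} {S : Finset (Fin n)}
    (hS : ∀ l, community ψ l \ community ψhat (p l) ⊆ S) :
    overallError ψ ψhat ≤ S.card / n := by
  refine (ciInf_le (Set.finite_range _).bddBelow p).trans ?_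
  rw [one_div, inv_mul_eq_div]
  refine div_le_div_of_nonneg_right ?_ (Nat.cast_nonneg n)
  rw [← Nat.cast_sum]
  norm_cast
  rw [← Finset.card_biUnion]
  · exact Finset.card_le_card (Finset.biUnion_subset.2 fun l _ => hS l)
  · intro l _ k _ hlk
    refine Finset.disjoint_left.2 fun i hi hi' => hlk ?_
    simp only [community, Finset.mem_sdiff, Finset.mem_filter, Finset.mem_univ, true_and] at hi hi'
    exact hi.1.symm.trans hi'.1

lemma worstError_le {ψ ψhat : Fin n → Fin m} {p : Equiv.Perm (Fin m)} {S : Finset (Fin n)}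
    (hS : ∀ l, community ψ l \ community ψhat (p l) ⊆ S) (hξ : 0 < minProportion ψ) (hn : 0 < n) :
    worstError ψ ψhat ≤ S.card / (minProportion ψ * n) := by
  have hn' : (0 : ℝ) < n := by exact_mod_cast hn
  refine (ciInf_le (Set.finite_range _).bddBelow p).trans
    (Real.iSup_le (fun l => ?_) (by positivity))
  refine div_le_div₀ (Nat.cast_nonneg _) ?_ (by positivity) (minProportion_mul_le ψ l)
  exact_mod_cast Finset.card_le_card (hS l)

end KMeans

/-! ### Trace duality for matrices of low rank -/

section LowRank

open scoped Matrix Matrix.Norms.L2Operator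

variable {m n k : Type*} [Fintype m] [Fintype n] [Fintype k]

lemma trace_transpose_mul_le (X Y : Matrix m n ℝ) : (Xᵀ * Y).trace ≤ frob X * frob Y := by
  have h := real_inner_le_norm
    (WithLp.toLp 2 fun p : m × n => X p.1 p.2 : EuclideanSpace ℝ (m × n))
    (WithLp.toLp 2 fun p : m × n => Y p.1 p.2)
  refine Eq.trans_le ?_ h
  simp only [Matrix.trace, Matrix.diag, Matrix.mul_apply, Matrix.transpose_apply,
    PiLp.inner_apply, RCLike.inner_apply, conj_trivial, Fintype.sum_prod_type]
  rw [Finset.sum_comm]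
  simp only [mul_comm]

/-- The trace pairing with a matrix of rank at most `card k`. -/
theorem trace_transpose_mul_le_of_factor [DecidableEq m] [DecidableEq n] (W : Matrix m n ℝ)
    (L : Matrix m k ℝ) (R : Matrix k n ℝ) :
    (Wᵀ * (L * R)).trace ≤ ‖W‖ * √(Fintype.card k) * frob (L * R) := by
  set D := L * R with hD
  -- The row space of `R` contains the rows of `D`. For an orthonormal basis `U` of it, `D U Uᵀ =
  -- D`, so the pairing of `W` and `D` equals that of `W U` and `D U`, and the Frobenius norm of `U`
  -- is the square root of the dimension of `V`.
  let V : Submodule ℝ (EuclideanSpace ℝ n) :=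
    Submodule.span ℝ (Set.range fun a => (WithLp.toLp 2 (R a) : EuclideanSpace ℝ n))
  have hmem : ∀ i, (WithLp.toLp 2 (D i) : EuclideanSpace ℝ n) ∈ V := by
    intro i
    have : (WithLp.toLp 2 (D i) : EuclideanSpace ℝ n) =
        ∑ a, L i a • (WithLp.toLp 2 (R a) : EuclideanSpace ℝ n) := by
      ext j
      simp [hD, Matrix.mul_apply]
    rw [this]
    exact Submodule.sum_mem _ fun a _ =>
      Submodule.smul_mem _ _ (Submodule.subset_span ⟨a, rfl⟩)
  let u := stdOrthonormalBasis ℝ V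
  let U : Matrix n (Fin (Module.finrank ℝ V)) ℝ :=
    Matrix.of fun j a => (u a : EuclideanSpace ℝ n) j
  have hUU : Uᵀ * U = 1 := by
    ext a b
    have h := orthonormal_iff_ite.1 u.orthonormal b a
    rw [Submodule.coe_inner, PiLp.inner_apply] at h
    rw [Matrix.one_apply, Matrix.mul_apply]
    simpa [U, eq_comm] using h
  have hDU : D * U * Uᵀ = D := by
    ext i j
    have h := congrArg (fun w : V => (w : EuclideanSpace ℝ n) j) (u.sum_repr' ⟨_, hmem i⟩)
    simp only [Submodule.coe_inner, PiLp.inner_apply] at h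
    simp only [Submodule.coe_sum, Submodule.coe_smul, WithLp.ofLp_sum, WithLp.ofLp_smul,
      Finset.sum_apply, Pi.smul_apply, smul_eq_mul] at h
    rw [← h]
    simp [Matrix.mul_apply, U]
  have hU1 : ‖U‖ ≤ 1 := by
    refine opNorm_le_of_forall U zero_le_one fun v => ?_
    have h := norm_mulVec_sq U v
    rw [hUU, Matrix.one_mulVec] at h
    rw [one_mul, ← sq_le_sq₀ (norm_nonneg _) (norm_nonneg _), h, EuclideanSpace.norm_sq_eq]
    simp [dotProduct, sq]
  have hUf : frob U ≤ √(Fintype.card k) := by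
    refine Real.le_sqrt_of_sq_le ?_
    have h : frob U ^ 2 = Module.finrank ℝ V := by
      have h1 : frob U ^ 2 = (Uᵀ * U).trace := by
        rw [frob_sq, Finset.sum_comm]
        simp [Matrix.trace, Matrix.mul_apply, sq]
      rw [h1, hUU, Matrix.trace_one, Fintype.card_fin]
    rw [h]
    exact_mod_cast finrank_range_le_card (R := ℝ)
      (fun a => (WithLp.toLp 2 (R a) : EuclideanSpace ℝ n))
  have hcomm : (Wᵀ * D).trace = ((W * U)ᵀ * (D * U)).trace := by
    conv_lhs => rw [← hDU]
    rw [← Matrix.mul_assoc, Matrix.trace_mul_comm, Matrix.transpose_mul]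
    simp only [Matrix.mul_assoc]
  rw [hcomm]
  refine (trace_transpose_mul_le _ _).trans (mul_le_mul ?_ ?_ (frob_nonneg _) (by positivity))
  · exact (frob_mul_le_left _ _).trans (mul_le_mul_of_nonneg_left hUf (norm_nonneg _))
  · exact (frob_mul_le_right _ _).trans (mul_le_of_le_one_right (frob_nonneg _) hU1)

end LowRank

/-! ### Nets and operator norms -/

section Net

open scoped Matrix Matrix.Norms.L2Operator

/-- A `1`-net of the ball of radius `2` with at most `5 ^ n` elements. -/
lemma exists_net (n : ℕ) : ∃ s : Finset (EuclideanSpace ℝ (Fin n)), s.card ≤ 5 ^ n ∧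
    (∀ c ∈ s, ‖c‖ ≤ 2) ∧ ∀ v : EuclideanSpace ℝ (Fin n), ‖v‖ ≤ 2 → ∃ c ∈ s, ‖v - c‖ < 1 := by
  classical
  -- A `1`-separated set of maximal size is a net, since otherwise a point could be added; volume
  -- packing bounds its size by `5 ^ n`.
  let P : ℕ → Prop := fun N => ∃ s : Finset (EuclideanSpace ℝ (Fin n)), s.card = N ∧
    (∀ c ∈ s, ‖c‖ ≤ 2) ∧ ∀ c ∈ s, ∀ d ∈ s, c ≠ d → 1 ≤ ‖c - d‖
  have hP : ∀ N, P N → N ≤ 5 ^ n := by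
    rintro N ⟨s, rfl, h1, h2⟩
    simpa using Besicovitch.card_le_of_separated s h1 h2
  have h0 : P 0 := ⟨∅, by simp⟩
  obtain ⟨s, hs, h1, h2⟩ : P (Nat.findGreatest P (5 ^ n)) :=
    Nat.findGreatest_spec (Nat.zero_le _) h0
  refine ⟨s, hP _ ⟨s, rfl, h1, h2⟩, h1, fun v hv => ?_⟩
  by_contra! hcon
  have hvs : v ∉ s := fun h => by simpa using (hcon v h).trans_lt' one_pos
  have h3 : P (s.card + 1) := by
    refine ⟨insert v s, Finset.card_insert_of_notMem hvs, ?_, ?_⟩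
    · simpa using ⟨hv, h1⟩
    · intro c hc d hd hcd
      rw [Finset.mem_insert] at hc hd
      rcases hc with rfl | hc <;> rcases hd with rfl | hd
      · exact absurd rfl hcd
      · exact hcon d hd
      · rw [norm_sub_rev]; exact hcon c hc
      · exact h2 c hc d hd hcd
  have := Nat.le_findGreatest (hP _ h3) h3
  omega

/-- Test against `2 u / ‖u‖`: the pairing is `2 ‖u‖`, and passing to the net loses at most `‖u‖`.
Radius `2` and mesh `1` thus leave no constant. -/
lemma norm_le_of_net {n : ℕ} {s : Finset (EuclideanSpace ℝ (Fin n))}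
    (hs : ∀ v : EuclideanSpace ℝ (Fin n), ‖v‖ ≤ 2 → ∃ c ∈ s, ‖v - c‖ < 1)
    {u : EuclideanSpace ℝ (Fin n)} {t : ℝ} (h : ∀ c ∈ s, inner ℝ c u ≤ t) (ht : 0 ≤ t) :
    ‖u‖ ≤ t := by
  rcases eq_or_ne u 0 with rfl | hu
  · simpa using ht
  have hu0 : 0 < ‖u‖ := norm_pos_iff.2 hu
  obtain ⟨c, hc, hvc⟩ := hs ((2 / ‖u‖) • u) (by
    rw [norm_smul, Real.norm_of_nonneg (by positivity), div_mul_cancel₀ _ hu0.ne'])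
  have h1 : inner ℝ ((2 / ‖u‖) • u) u = 2 * ‖u‖ := by
    rw [real_inner_smul_left, real_inner_self_eq_norm_sq]; field_simp
  have h2 := real_inner_le_norm ((2 / ‖u‖) • u - c) u
  rw [inner_sub_left, h1] at h2
  nlinarith [h c hc]

/-- The net replaces the left vector by `norm_le_of_net`, then the right one by the self-bounding
inequality `‖W‖ ≤ (t + ‖W‖) / 2`. -/
lemma opNorm_le_of_net {n : ℕ} {s : Finset (EuclideanSpace ℝ (Fin n))}
    (hs : ∀ v : EuclideanSpace ℝ (Fin n), ‖v‖ ≤ 2 → ∃ c ∈ s, ‖v - c‖ < 1)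
    {W : Matrix (Fin n) (Fin n) ℝ} {t : ℝ} (ht : 0 ≤ t)
    (h : ∀ c ∈ s, ∀ d ∈ s, ∑ i, ∑ j, c i * d j * W i j ≤ t) : ‖W‖ ≤ t := by
  have h1 : ∀ d ∈ s, ‖(WithLp.toLp 2 (W *ᵥ d.ofLp) : EuclideanSpace ℝ (Fin n))‖ ≤ t := by
    intro d hd
    refine norm_le_of_net hs (fun c hc => ?_) ht
    refine Eq.trans_le ?_ (h c hc d hd)
    simp only [PiLp.inner_apply, Matrix.mulVec, dotProduct, RCLike.inner_apply, conj_trivial,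
      Finset.sum_mul]
    exact Finset.sum_congr rfl fun i _ => Finset.sum_congr rfl fun j _ => by ring
  have h2 : ‖W‖ ≤ (t + ‖W‖) / 2 := by
    refine opNorm_le_of_forall W (by positivity) fun w => ?_
    rcases eq_or_ne w 0 with rfl | hw
    · simp
    set r := ‖WithLp.toLp 2 w‖ with hr
    have hr0 : 0 < r := norm_pos_iff.2 (by simpa using hw)
    obtain ⟨d, hd, hvd⟩ := hs ((2 / r) • WithLp.toLp 2 w) (by
      rw [norm_smul, Real.norm_of_nonneg (by positivity), div_mul_cancel₀ _ hr0.ne'])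
    have h3 : (2 / r) • WithLp.toLp 2 (W *ᵥ w) = WithLp.toLp 2 (W *ᵥ d.ofLp) +
        WithLp.toLp 2 (W *ᵥ ((2 / r) • w - d.ofLp)) := by
      rw [← WithLp.toLp_add, ← WithLp.toLp_smul, Matrix.mulVec_sub, Matrix.mulVec_smul]
      congr 1
      abel
    have h4 := norm_add_le (WithLp.toLp 2 (W *ᵥ d.ofLp) : EuclideanSpace ℝ (Fin n))
      (WithLp.toLp 2 (W *ᵥ ((2 / r) • w - d.ofLp)))
    rw [← h3, norm_smul, Real.norm_of_nonneg (by positivity)] at h4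
    have h5 : ‖(WithLp.toLp 2 (W *ᵥ ((2 / r) • w - d.ofLp)) : EuclideanSpace ℝ (Fin n))‖ ≤ ‖W‖ :=
      (norm_mulVec_le _ _).trans (mul_le_of_le_one_right (norm_nonneg _) hvd.le)
    have h6 := h4.trans (add_le_add (h1 d hd) h5)
    rw [div_mul_eq_mul_div, div_le_iff₀ hr0] at h6
    linarith
  linarith

end Net

/-! ### Concentration of the score matrix -/

section Concentration

open scoped Matrix Matrix.Norms.L2Operator NNReal

variable {Ω : Type*} [MeasurableSpace Ω] {P : Measure Ω}

lemma hasSubgaussianMGF_mono {X : Ω → ℝ} {c d : ℝ≥0} (h : HasSubgaussianMGF X c P) (hcd : c ≤ d) :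
    HasSubgaussianMGF X d P where
  integrable_exp_mul := h.integrable_exp_mul
  mgf_le t := (h.mgf_le t).trans (Real.exp_le_exp.2 (by gcongr))

/-- A double sum over `Fin n`, folded onto the pairs on and above the diagonal. -/
lemma sum_sum_eq_sum_upper {n : ℕ} (a : Fin n → Fin n → ℝ) :
    ∑ i, ∑ j, a i j = ∑ e : {e : Fin n × Fin n // e.1 ≤ e.2},
      (a e.1.1 e.1.2 + if e.1.1 = e.1.2 then 0 else a e.1.2 e.1.1) := by
  set s := Finset.univ.filter fun e : Fin n × Fin n => e.1 ≤ e.2 with hs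
  rw [← Finset.sum_subtype s (by simp [hs]) fun e : Fin n × Fin n =>
      a e.1 e.2 + if e.1 = e.2 then 0 else a e.2 e.1, Finset.sum_add_distrib,
    ← Fintype.sum_prod_type' a,
    ← Finset.sum_filter_add_sum_filter_not Finset.univ fun e : Fin n × Fin n => e.1 ≤ e.2]
  congr 1
  rw [Finset.sum_ite, Finset.sum_const_zero, zero_add]
  refine Finset.sum_nbij' Prod.swap Prod.swap ?_ ?_ (fun _ _ => rfl) (fun _ _ => rfl)
    (fun _ _ => rfl)
  · intro e he
    simp only [hs, Finset.mem_filter, Finset.mem_univ, true_and, not_le, Prod.fst_swap,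
      Prod.snd_swap] at he ⊢
    exact ⟨he.le, he.ne⟩
  · intro e he
    simp only [hs, Finset.mem_filter, Finset.mem_univ, true_and, not_le, Prod.fst_swap,
      Prod.snd_swap] at he ⊢
    exact lt_of_le_of_ne he.1 he.2

variable [IsProbabilityMeasure P] {n : ℕ} {f : ℝ → ℝ} {d₀ d₁ : ℝ}
  {M : Fin n → Fin n → ℝ} {Y : Ω → Fin n → Fin n → ℤ}

lemma IsSignedNetwork.measureReal_eq (hY : IsSignedNetwork P f d₀ d₁ M Y) (i j : Fin n) (t : ℤ) :
    P.real {ω | Y ω i j = t} = pmfP f d₀ d₁ t (M i j) := by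
  have hm : MeasurableSet {ω | t + 1 ≤ Y ω i j} :=
    measurableSet_le measurable_const (hY.measurable i j)
  have hu : {ω | t ≤ Y ω i j} = {ω | Y ω i j = t} ∪ {ω | t + 1 ≤ Y ω i j} := by
    ext ω
    simp only [Set.mem_ofPred_eq, Set.mem_union]
    omega
  have hd : Disjoint {ω | Y ω i j = t} {ω | t + 1 ≤ Y ω i j} := by
    refine Set.disjoint_left.2 fun ω h h' => ?_
    simp only [Set.mem_ofPred_eq] at h h'
    omega
  have h := hY.law i j t
  rw [hu, measureReal_union hd hm, hY.law i j (t + 1)] at h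
  unfold pmfP
  linarith

/-- The expectation of `p' / p` is the sum of the `p'`, which vanishes because the probabilities sum
to one. -/
lemma IsSignedNetwork.integral_score (hf : IsLink f) (hd : d₁ ≤ d₀) {α : ℝ}
    (hH : 0 < constH f d₀ d₁ α) (hY : IsSignedNetwork P f d₀ d₁ M Y) (i j : Fin n)
    (hM : |M i j| ≤ α) : ∫ ω, score f d₀ d₁ (Y ω i j) (M i j) ∂P = 0 := by
  have hm (t : ℤ) : MeasurableSet {ω | Y ω i j = t} :=
    measurableSet_eq_fun (hY.measurable i j) measurable_const
  have hsum : (fun ω => score f d₀ d₁ (Y ω i j) (M i j)) = fun ω =>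
      ∑ t ∈ ({-1, 0, 1} : Finset ℤ),
        {ω | Y ω i j = t}.indicator (fun _ => score f d₀ d₁ t (M i j)) ω := by
    funext ω
    have h : Y ω i j = -1 ∨ Y ω i j = 0 ∨ Y ω i j = 1 := hY.mem_support ω i j
    rcases h with h | h | h <;> simp [Set.indicator, h]
  rw [hsum, integral_finsetSum _ fun t _ => (integrable_const _).indicator (hm t)]
  have hterm : ∀ t ∈ ({-1, 0, 1} : Finset ℤ),
      ∫ ω, {ω | Y ω i j = t}.indicator (fun _ => score f d₀ d₁ t (M i j)) ω ∂P
        = deriv (pmfP f d₀ d₁ t) (M i j) := by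
    intro t ht
    have ht' : t ∈ edgeSupport := by simpa [edgeSupport] using ht
    rw [integral_indicator_const _ (hm t), hY.measureReal_eq, smul_eq_mul, score,
      mul_div_cancel₀ _ (hf.pmfP_pos hd hH ht' hM).ne']
  rw [Finset.sum_congr rfl hterm]
  have := hf.sum_deriv_pmfP (d₀ := d₀) (d₁ := d₁) (M i j)
  simpa [add_assoc] using this

/-- The matrix of scores. -/
noncomputable def scoreMatrix (f : ℝ → ℝ) (d₀ d₁ : ℝ) (M : Fin n → Fin n → ℝ)
    (y : Fin n → Fin n → ℤ) : Matrix (Fin n) (Fin n) ℝ :=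
  Matrix.of fun i j => score f d₀ d₁ (y i j) (M i j)

lemma IsSignedNetwork.hasSubgaussianMGF_score (hf : IsLink f) (hd : d₁ ≤ d₀) {α : ℝ}
    (hH : 0 < constH f d₀ d₁ α) (hG : BddAbove (steepnessSet f d₀ d₁ α))
    (hY : IsSignedNetwork P f d₀ d₁ M Y) (i j : Fin n) (hM : |M i j| ≤ α) :
    HasSubgaussianMGF (fun ω => score f d₀ d₁ (Y ω i j) (M i j))
      (‖constG f d₀ d₁ α‖₊ ^ 2) P := by
  have h := hasSubgaussianMGF_of_mem_Icc_of_integral_eq_zero (μ := P)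
    (X := fun ω => score f d₀ d₁ (Y ω i j) (M i j))
    (a := -constG f d₀ d₁ α) (b := constG f d₀ d₁ α)
    ((measurable_of_countable fun t : ℤ => score f d₀ d₁ t (M i j)).comp
      (hY.measurable i j)).aemeasurable
    (ae_of_all _ fun ω => abs_le.1 (hf.abs_score_le hd hH hG (hY.mem_support ω i j) hM))
    (hY.integral_score hf hd hH i j hM)
  convert h using 2
  rw [sub_neg_eq_add, ← two_mul, nnnorm_mul]
  simp

/-- Entries `(i, j)` and `(j, i)` are one variable, so the sum is folded before independence is
used. The squared folded coefficients add up to at most `2 ‖c‖² ‖d‖² ≤ 32`; Hoeffding's lemma then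
gives the variance proxy `32 G²`. -/
lemma IsSignedNetwork.measureReal_bilin_ge_le (hf : IsLink f) (hd : d₁ ≤ d₀) {α : ℝ}
    (hH : 0 < constH f d₀ d₁ α) (hG : BddAbove (steepnessSet f d₀ d₁ α))
    (hY : IsSignedNetwork P f d₀ d₁ M Y) (hM : ∀ i j, |M i j| ≤ α)
    (hMs : ∀ i j, M i j = M j i)
    {c d : EuclideanSpace ℝ (Fin n)} (hc : ‖c‖ ≤ 2) (hd2 : ‖d‖ ≤ 2) {t : ℝ} (ht : 0 ≤ t) :
    P.real {ω | t ≤ ∑ i, ∑ j, c i * d j * scoreMatrix f d₀ d₁ M (Y ω) i j} ≤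
      Real.exp (-t ^ 2 / (64 * constG f d₀ d₁ α ^ 2)) := by
  set G := constG f d₀ d₁ α with hGdef
  let coef : {e : Fin n × Fin n // e.1 ≤ e.2} → ℝ := fun e =>
    c e.1.1 * d e.1.2 + if e.1.1 = e.1.2 then 0 else c e.1.2 * d e.1.1
  let X : {e : Fin n × Fin n // e.1 ≤ e.2} → Ω → ℝ := fun e ω =>
    coef e * score f d₀ d₁ (Y ω e.1.1 e.1.2) (M e.1.1 e.1.2)
  have hX : ∀ ω, ∑ i, ∑ j, c i * d j * scoreMatrix f d₀ d₁ M (Y ω) i j = ∑ e, X e ω := by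
    intro ω
    rw [sum_sum_eq_sum_upper]
    refine Finset.sum_congr rfl fun e _ => ?_
    simp only [X, coef, scoreMatrix, Matrix.of_apply]
    rw [hY.symm ω e.1.2 e.1.1, hMs e.1.2 e.1.1]
    split_ifs <;> ring
  have hind : iIndepFun X P := by
    have := hY.indep.comp (fun e (y : ℤ) => coef e * score f d₀ d₁ y (M e.1.1 e.1.2))
      fun e => measurable_of_countable _
    exact this
  let q : {e : Fin n × Fin n // e.1 ≤ e.2} → ℝ≥0 := fun e => ⟨coef e ^ 2, sq_nonneg _⟩
  have hsub := HasSubgaussianMGF.sum_of_iIndepFun hind (c := fun e => q e * ‖G‖₊ ^ 2)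
    (s := Finset.univ) fun e _ =>
      (hY.hasSubgaussianMGF_score hf hd hH hG e.1.1 e.1.2 (hM _ _)).const_mul (coef e)
  have hcoef : ∑ e, coef e ^ 2 ≤ 32 := by
    have h1 : ∑ e, coef e ^ 2 ≤ ∑ i, ∑ j, 2 * (c i ^ 2 * d j ^ 2) := by
      rw [sum_sum_eq_sum_upper]
      refine Finset.sum_le_sum fun e _ => ?_
      simp only [coef]
      split_ifs
      · nlinarith [sq_nonneg (c e.1.1 * d e.1.2)]
      · nlinarith [sq_nonneg (c e.1.1 * d e.1.2 - c e.1.2 * d e.1.1)]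
    have h2 : ∑ i, ∑ j, 2 * (c i ^ 2 * d j ^ 2) = 2 * (‖c‖ ^ 2 * ‖d‖ ^ 2) := by
      rw [EuclideanSpace.norm_sq_eq, EuclideanSpace.norm_sq_eq, Finset.sum_mul_sum]
      simp only [Real.norm_eq_abs, sq_abs, Finset.mul_sum]
    have h3 : ‖c‖ ^ 2 ≤ 2 ^ 2 := pow_le_pow_left₀ (norm_nonneg _) hc 2
    have h4 : ‖d‖ ^ 2 ≤ 2 ^ 2 := pow_le_pow_left₀ (norm_nonneg _) hd2 2
    have h5 := mul_le_mul h3 h4 (sq_nonneg _) (by norm_num)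
    linarith
  have hsub' : HasSubgaussianMGF (fun ω => ∑ e, X e ω) (32 * ‖G‖₊ ^ 2) P := by
    refine hasSubgaussianMGF_mono hsub ?_
    rw [← Finset.sum_mul]
    refine mul_le_mul_left ?_ _
    rw [← NNReal.coe_le_coe, NNReal.coe_sum]
    exact hcoef
  have h := hsub'.measure_ge_le ht
  simp only [hX]
  refine h.trans_eq ?_
  congr 2
  push_cast
  rw [Real.norm_eq_abs, sq_abs]
  ring

/-- With probability at least `1 - exp (-n)` the operator norm of the score matrix is of the
order `G √n`. -/
theorem IsSignedNetwork.one_sub_exp_le_measureReal (hf : IsLink f) (hd : d₁ ≤ d₀) {α : ℝ}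
    (hH : 0 < constH f d₀ d₁ α) (hG : BddAbove (steepnessSet f d₀ d₁ α))
    (hG0 : 0 < constG f d₀ d₁ α)
    (hY : IsSignedNetwork P f d₀ d₁ M Y) (hM : ∀ i j, |M i j| ≤ α)
    (hMs : ∀ i j, M i j = M j i) :
    1 - Real.exp (-n) ≤
      P.real {ω | ‖scoreMatrix f d₀ d₁ M (Y ω)‖ ≤ 18 * constG f d₀ d₁ α * √n} := by
  set G := constG f d₀ d₁ α with hGdef
  obtain ⟨s, hscard, hs2, hs⟩ := exists_net n
  -- `18² / 64 > 5`, so each pair of net points fails with probability at most `exp (-5 n)`, against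
  -- at most `25 ^ n ≤ exp (4 n)` pairs.
  set t := 18 * G * √n with ht
  have ht0 : 0 ≤ t := by positivity
  set good := {ω | ‖scoreMatrix f d₀ d₁ M (Y ω)‖ ≤ t}
  set bad := ⋃ q ∈ s ×ˢ s, {ω | t ≤ ∑ i, ∑ j, q.1 i * q.2 j * scoreMatrix f d₀ d₁ M (Y ω) i j}
  -- Covering and subadditivity bound `P.real good` from below without its measurability.
  have hcov : Set.univ ⊆ good ∪ bad := by
    intro ω _
    by_contra hω
    simp only [good, bad, Set.mem_union, Set.mem_iUnion, Set.mem_ofPred_eq, not_or, not_exists,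
      Finset.mem_product, exists_prop, not_and, Prod.forall] at hω
    exact hω.1 (opNorm_le_of_net hs ht0 fun c hc d hd => (not_le.1 (hω.2 c d ⟨hc, hd⟩)).le)
  have hbad : P.real bad ≤ Real.exp (-n) := by
    refine (measureReal_biUnion_finset_le _ _).trans ?_
    have h1 : ∀ q ∈ s ×ˢ s, P.real {ω | t ≤ ∑ i, ∑ j, q.1 i * q.2 j *
        scoreMatrix f d₀ d₁ M (Y ω) i j} ≤ Real.exp (-5 * n) := by
      intro q hq
      rw [Finset.mem_product] at hq
      refine (hY.measureReal_bilin_ge_le hf hd hH hG hM hMs (hs2 _ hq.1) (hs2 _ hq.2) ht0).trans ?_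
      refine Real.exp_le_exp.2 ?_
      rw [← hGdef, ht, mul_pow, mul_pow, Real.sq_sqrt (Nat.cast_nonneg n),
        div_le_iff₀ (by positivity)]
      have : 0 ≤ G ^ 2 * n := by positivity
      nlinarith
    refine (Finset.sum_le_card_nsmul _ _ _ h1).trans ?_
    rw [Finset.card_product, nsmul_eq_mul]
    have h2 : ((s.card * s.card : ℕ) : ℝ) ≤ Real.exp (4 * n) := by
      have h3 : ((s.card * s.card : ℕ) : ℝ) ≤ 25 ^ n := by
        have := Nat.mul_le_mul hscard hscard
        rw [← mul_pow] at this
        exact_mod_cast this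
      refine h3.trans ?_
      rw [mul_comm, Real.exp_nat_mul]
      refine pow_le_pow_left₀ (by norm_num) ?_ n
      have h4 : Real.exp 4 = Real.exp 1 ^ 4 := by
        rw [← Real.exp_nat_mul]; norm_num
      rw [h4]
      have h5 : (2.7 : ℝ) ≤ Real.exp 1 := by linarith [Real.exp_one_gt_d9]
      calc (25 : ℝ) ≤ 2.7 ^ 4 := by norm_num
        _ ≤ _ := pow_le_pow_left₀ (by norm_num) h5 4
    refine (mul_le_mul_of_nonneg_right h2 (Real.exp_pos _).le).trans_eq ?_
    rw [← Real.exp_add]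
    congr 1
    ring
  have h1 : (1 : ℝ) ≤ P.real good + P.real bad := by
    have := (measureReal_mono hcov).trans (measureReal_union_le (μ := P) good bad)
    rwa [probReal_univ] at this
  linarith

end Concentration

/-! ### From the likelihood to the Gram matrices -/

section Estimation

open scoped Matrix Matrix.Norms.L2Operator

variable {n K K₁ K₂ : ℕ}

/-- The matrix whose rows are the points of an embedding. -/
def Emb.toMat (X : Emb n K) : Matrix (Fin n) (Fin K) ℝ := Matrix.of fun i k => X i k

lemma Emb.toMat_apply (X : Emb n K) (i : Fin n) (k : Fin K) : X.toMat i k = X i k := rfl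

lemma Emb.toMat_mul_transpose_apply (X : Emb n K) (i j : Fin n) :
    (X.toMat * X.toMatᵀ) i j = inner ℝ (X i) (X j) := by
  simp [Matrix.mul_apply, Emb.toMat_apply, PiLp.inner_apply, mul_comm]

lemma Emb.gramMatrix_eq (X : Emb n K) : gramMatrix X = X.toMatᵀ * X.toMat := by
  ext k l
  simp [gramMatrix, Matrix.mul_apply, Emb.toMat_apply]

lemma Emb.frobNorm_eq (X : Emb n K) : frobNorm X = frob X.toMat := by
  rw [frobNorm, Real.sqrt_eq_iff_eq_sq (by positivity) (frob_nonneg _), frob_sq]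
  simp [EuclideanSpace.norm_sq_eq, Emb.toMat_apply]

lemma CentredOrth.transpose_mul {B : Emb n K₁} {A : Emb n K₂} (h : CentredOrth B A) :
    B.toMatᵀ * A.toMat = 0 := by
  ext k l
  simpa [Matrix.mul_apply, Emb.toMat_apply] using h.orth k l

lemma paramM_eq (B : Emb n K₁) (A : Emb n K₂) (i j : Fin n) :
    paramM B A i j = -‖B i‖ ^ 2 - ‖B j‖ ^ 2 + 2 * inner ℝ (B i) (B j) + inner ℝ (A i) (A j) := by
  rw [paramM, norm_sub_sq_real]
  ring

lemma paramM_comm (B : Emb n K₁) (A : Emb n K₂) (i j : Fin n) :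
    paramM B A i j = paramM B A j i := by
  rw [paramM, paramM, norm_sub_rev, real_inner_comm]

/-- The difference of two parameter matrices. -/
noncomputable def paramDiff (B' B : Emb n K₁) (A' A : Emb n K₂) : Matrix (Fin n) (Fin n) ℝ :=
  Matrix.of fun i j => paramM B' A' i j - paramM B A i j

/-- A difference of parameter matrices has rank at most `2 (K + 2)`. -/
lemma exists_factor_paramDiff (B' B : Emb n K₁) (A' A : Emb n K₂) :
    ∃ (L : Matrix (Fin n) (Fin 2 ⊕ (Fin K₁ ⊕ Fin K₁) ⊕ (Fin K₂ ⊕ Fin K₂)) ℝ)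
      (R : Matrix (Fin 2 ⊕ (Fin K₁ ⊕ Fin K₁) ⊕ (Fin K₂ ⊕ Fin K₂)) (Fin n) ℝ),
      paramDiff B' B A' A = L * R := by
  refine ⟨Matrix.of fun i => Sum.elim ![‖B i‖ ^ 2 - ‖B' i‖ ^ 2, 1]
      (Sum.elim (Sum.elim (fun k => 2 * B' i k) fun k => -2 * B i k)
        (Sum.elim (fun k => A' i k) fun k => -A i k)),
    Matrix.of fun a j => Sum.elim ![1, ‖B j‖ ^ 2 - ‖B' j‖ ^ 2]
      (Sum.elim (Sum.elim (fun k => B' j k) fun k => B j k)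
        (Sum.elim (fun k => A' j k) fun k => A j k)) a, ?_⟩
  ext i j
  simp only [paramDiff, Matrix.of_apply, paramM_eq, Matrix.mul_apply, Fintype.sum_sum_type,
    Sum.elim_inl, Sum.elim_inr, Fin.sum_univ_two, Matrix.cons_val_zero, Matrix.cons_val_one,
    PiLp.inner_apply, RCLike.inner_apply, conj_trivial, neg_mul, Finset.sum_neg_distrib, mul_assoc,
    ← Finset.mul_sum]
  simp only [mul_comm (B' j _), mul_comm (B j _), mul_comm (A' j _), mul_comm (A j _)]
  ring

lemma sum_mul_paramDiff_le (W : Matrix (Fin n) (Fin n) ℝ) (B' B : Emb n K₁) (A' A : Emb n K₂) :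
    ∑ i, ∑ j, W i j * paramDiff B' B A' A i j ≤
      ‖W‖ * √(2 * (((K₁ + K₂ : ℕ) : ℝ) + 2)) * frob (paramDiff B' B A' A) := by
  obtain ⟨L, R, h⟩ := exists_factor_paramDiff B' B A' A
  have h1 := trace_transpose_mul_le_of_factor W L R
  rw [← h] at h1
  have h2 : (Wᵀ * paramDiff B' B A' A).trace = ∑ i, ∑ j, W i j * paramDiff B' B A' A i j := by
    rw [Finset.sum_comm]
    simp [Matrix.trace, Matrix.mul_apply]
  rw [← h2]
  refine h1.trans ?_
  have h3 := frob_nonneg (paramDiff B' B A' A)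
  gcongr
  -- The factorisation has inner dimension `2 (K + 1)`, enlarged here to `2 (K + 2)`.
  simp only [Fintype.card_sum, Fintype.card_fin]
  push_cast
  linarith

/-- The basic inequality for the maximum likelihood estimator. -/
theorem IsEstimate.frob_paramDiff_le {f : ℝ → ℝ} {d₀ d₁ C κ a : ℝ} (hf : IsLink f) (hd : d₁ ≤ d₀)
    (hH : 0 < constH f d₀ d₁ (radius C d₀)) {y : Fin n → Fin n → ℤ}
    (hy : ∀ i j, y i j ∈ edgeSupport) {B B' : Emb n K₁} {A A' : Emb n K₂}
    (hfeas : Feasible C κ a B A) (hest : IsEstimate f d₀ d₁ C κ a y B' A') :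
    frob (paramDiff B' B A' A) ≤ 2 / constH f d₀ d₁ (radius C d₀) *
      (‖scoreMatrix f d₀ d₁ (paramM B A) y‖ * √(2 * (((K₁ + K₂ : ℕ) : ℝ) + 2))) := by
  set H := constH f d₀ d₁ (radius C d₀) with hHdef
  set W := scoreMatrix f d₀ d₁ (paramM B A) y
  set D := paramDiff B' B A' A with hD
  have h1 : logLik f d₀ d₁ y B' A' - logLik f d₀ d₁ y B A ≤
      ∑ i, ∑ j, (W i j * D i j - H / 2 * D i j ^ 2) := by
    unfold logLik
    rw [← Finset.sum_sub_distrib]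
    refine Finset.sum_le_sum fun i _ => ?_
    rw [← Finset.sum_sub_distrib]
    exact Finset.sum_le_sum fun j _ => hf.log_pmfP_sub_le hd hH (hy i j)
      (abs_paramM_le d₀ hest.1.bound_B hest.1.bound_A i j)
      (abs_paramM_le d₀ hfeas.bound_B hfeas.bound_A i j)
  -- The truth is a competitor, so the left side of `h1` is nonnegative: the quadratic term is at
  -- most the linear one, and one factor `frob D` cancels.
  have h2 := hest.2 B A hfeas
  have h3 : ∑ i, ∑ j, (W i j * D i j - H / 2 * D i j ^ 2) =
      ∑ i, ∑ j, W i j * D i j - H / 2 * frob D ^ 2 := by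
    simp only [frob_sq, Finset.sum_sub_distrib, Finset.mul_sum]
  have h4 := sum_mul_paramDiff_le W B' B A' A
  rw [← hD] at h4
  rcases (frob_nonneg D).eq_or_lt with h0 | h0
  · rw [← h0]; positivity
  rw [div_mul_eq_mul_div, le_div_iff₀ hH]
  refine le_of_mul_le_mul_right ?_ h0
  nlinarith

/-- Centring makes the row and column sums of the Gram part `E` vanish, so `E` is orthogonal to the
remaining part `u i + u j`, and Pythagoras applies. -/
lemma frob_gram_diff_le {B B' : Emb n K₁} {A A' : Emb n K₂} (h : CentredOrth B A)
    (h' : CentredOrth B' A') :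
    frob (2 • (B'.toMat * B'.toMatᵀ - B.toMat * B.toMatᵀ) +
      (A'.toMat * A'.toMatᵀ - A.toMat * A.toMatᵀ)) ≤ frob (paramDiff B' B A' A) := by
  set E := 2 • (B'.toMat * B'.toMatᵀ - B.toMat * B.toMatᵀ) +
      (A'.toMat * A'.toMatᵀ - A.toMat * A.toMatᵀ) with hE
  have hEij : ∀ i j, E i j = 2 * (inner ℝ (B' i) (B' j) - inner ℝ (B i) (B j)) +
      (inner ℝ (A' i) (A' j) - inner ℝ (A i) (A j)) := fun i j => by
    simp only [hE, two_nsmul, Matrix.add_apply, Matrix.sub_apply, Emb.toMat_mul_transpose_apply]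
    ring
  have hrow : ∀ i, ∑ j, E i j = 0 := fun i => by
    simp only [hEij, Finset.sum_add_distrib, Finset.sum_sub_distrib, ← Finset.mul_sum,
      ← inner_sum, h.sum_B, h.sum_A, h'.sum_B, h'.sum_A, inner_zero_right]
    norm_num
  have hsymm : ∀ i j, E i j = E j i := fun i j => by
    rw [hEij, hEij, real_inner_comm (B' i), real_inner_comm (B i), real_inner_comm (A' i),
      real_inner_comm (A i)]
  set u : Fin n → ℝ := fun i => ‖B i‖ ^ 2 - ‖B' i‖ ^ 2 with hu
  have hD : ∀ i j, paramDiff B' B A' A i j = E i j + (u i + u j) := fun i j => by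
    simp only [paramDiff, Matrix.of_apply, paramM_eq, hEij, hu]
    ring
  have hcross : ∑ i, ∑ j, E i j * (u i + u j) = 0 := by
    have h1 : ∑ i, ∑ j, E i j * u i = 0 := by
      simp only [← Finset.sum_mul, hrow, zero_mul, Finset.sum_const_zero]
    have h2 : ∑ i, ∑ j, E i j * u j = 0 := by
      rw [Finset.sum_comm]
      refine Finset.sum_eq_zero fun j _ => ?_
      rw [← Finset.sum_mul, Finset.sum_congr rfl fun i _ => hsymm i j, hrow, zero_mul]
    simp only [mul_add, Finset.sum_add_distrib, h1, h2, add_zero]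
  rw [← sq_le_sq₀ (frob_nonneg _) (frob_nonneg _), frob_sq, frob_sq]
  have h3 : ∑ i, ∑ j, paramDiff B' B A' A i j ^ 2 = ∑ i, ∑ j, E i j ^ 2 +
      2 * ∑ i, ∑ j, E i j * (u i + u j) + ∑ i, ∑ j, (u i + u j) ^ 2 := by
    simp only [hD, Finset.mul_sum, ← Finset.sum_add_distrib]
    exact Finset.sum_congr rfl fun i _ => Finset.sum_congr rfl fun j _ => by ring
  rw [h3, hcross]
  have : 0 ≤ ∑ i, ∑ j, (u i + u j) ^ 2 :=
    Finset.sum_nonneg fun i _ => Finset.sum_nonneg fun j _ => sq_nonneg _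
  linarith

/-- Through the scale constraint a small `a` makes `A` negligible, as `exists_alignment` requires of
both the true and the estimated embedding. -/
lemma Feasible.norm_toMat_sq_le {C κ a : ℝ} (ha : 0 ≤ a) {B : Emb n K₁}
    {A : Emb n K₂} (h : Feasible C κ a B A) : ‖A.toMat‖ ^ 2 ≤ κ ^ 2 * a * (C ^ 2) * n := by
  have h1 : ‖A.toMat‖ ≤ κ * √a * frobNorm B := by
    refine (opNorm_le_frob _).trans ?_
    rw [← Emb.frobNorm_eq]
    exact h.scale
  refine (pow_le_pow_left₀ (norm_nonneg _) h1 2).trans ?_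
  have h2 : frobNorm B ^ 2 ≤ C ^ 2 * n := by
    rw [frobNorm, Real.sq_sqrt (by positivity)]
    refine (Finset.sum_le_card_nsmul _ _ (C ^ 2) fun i _ =>
      pow_le_pow_left₀ (norm_nonneg _) (h.bound_B i) 2).trans_eq ?_
    simp [mul_comm]
  rw [mul_pow, mul_pow, Real.sq_sqrt ha, mul_assoc (κ ^ 2 * a)]
  gcongr

/-- The rows of `B Q` are the transformed centres, so the alignment error is the K-means cost of the
true labels. -/
lemma kmeansCost_eq_frob {m : ℕ} {B B' : Emb n K} {b : Emb m K} {ψ : Fin n → Fin m}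
    (hb : ∀ i, B i = b (ψ i)) (Q : Matrix (Fin K) (Fin K) ℝ) :
    kmeansCost B' ψ (fun l => WithLp.toLp 2 (Qᵀ *ᵥ (b l).ofLp)) =
      frob (B'.toMat - B.toMat * Q) ^ 2 := by
  rw [kmeansCost, frob_sq]
  refine Finset.sum_congr rfl fun i _ => ?_
  rw [EuclideanSpace.norm_sq_eq]
  refine Finset.sum_congr rfl fun k _ => ?_
  rw [Real.norm_eq_abs, sq_abs, ← hb]
  simp [Matrix.mulVec, dotProduct, Matrix.mul_apply, Emb.toMat_apply, mul_comm]

end Estimation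

/-! ### Consequences of the limits, and the error bounds -/

section Asymptotic

open scoped Matrix Matrix.Norms.L2Operator

lemma norm_toLp_sq {k : Type*} [Fintype k] (v : k → ℝ) :
    ‖(WithLp.toLp 2 v : EuclideanSpace ℝ k)‖ ^ 2 = v ⬝ᵥ v := by
  simp [EuclideanSpace.norm_sq_eq, dotProduct, ← sq]

lemma quadForm_mem_of_spectrum {k : Type*} [Fintype k] [DecidableEq k] {S : Matrix k k ℝ}
    (hS : S.IsHermitian) {lam Lam : ℝ} (h : spectrum ℝ S ⊆ Set.Icc lam Lam) (v : k → ℝ) :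
    lam * ‖WithLp.toLp 2 v‖ ^ 2 ≤ v ⬝ᵥ (S *ᵥ v) ∧
      v ⬝ᵥ (S *ᵥ v) ≤ Lam * ‖WithLp.toLp 2 v‖ ^ 2 := by
  have halg (r : ℝ) : (algebraMap ℝ (Matrix k k ℝ) r).IsHermitian := by
    rw [Matrix.algebraMap_eq_diagonal]
    exact Matrix.isHermitian_diagonal _
  have halgv (r : ℝ) : v ⬝ᵥ (algebraMap ℝ (Matrix k k ℝ) r *ᵥ v) = r * ‖WithLp.toLp 2 v‖ ^ 2 := by
    rw [norm_toLp_sq, Algebra.algebraMap_eq_smul_one, Matrix.smul_mulVec, Matrix.one_mulVec,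
      dotProduct_smul, smul_eq_mul]
  constructor
  · have h1 : (S - algebraMap ℝ _ lam).PosSemidef := by
      rw [Matrix.posSemidef_iff_isHermitian_and_spectrum_nonneg]
      refine ⟨hS.sub (halg lam), ?_⟩
      rw [← spectrum.sub_singleton_eq]
      rintro _ ⟨x, hx, y, rfl, rfl⟩
      exact sub_nonneg.2 (h hx).1
    have h2 := h1.dotProduct_mulVec_nonneg v
    rw [star_trivial, Matrix.sub_mulVec, dotProduct_sub, halgv] at h2
    linarith
  · have h1 : (algebraMap ℝ _ Lam - S).PosSemidef := by
      rw [Matrix.posSemidef_iff_isHermitian_and_spectrum_nonneg]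
      refine ⟨(halg Lam).sub hS, ?_⟩
      rw [← spectrum.singleton_sub_eq]
      rintro _ ⟨x, rfl, y, hy, rfl⟩
      exact sub_nonneg.2 (h hy).2
    have h2 := h1.dotProduct_mulVec_nonneg v
    rw [star_trivial, Matrix.sub_mulVec, dotProduct_sub, halgv] at h2
    linarith

lemma continuous_frob {m k : Type*} [Fintype m] [Fintype k] :
    Continuous fun X : m → k → ℝ => frob (Matrix.of X) := by
  unfold frob
  refine continuous_norm.comp ((PiLp.continuous_toLp 2 _).comp ?_)
  simp only [Matrix.of_apply]
  fun_prop

/-- Once the scaled Gram matrix is within `lam / 2` of `S`, its quadratic form lies between `lam -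
lam / 2` and `Lam + lam / 2 ≤ 2 * Lam`. -/
lemma eventually_gram_bounds {K : ℕ} {B : (n : ℕ) → Emb n K} {S : Matrix (Fin K) (Fin K) ℝ}
    {lam Lam : ℝ} (hlam : 0 < lam) (hLam : lam ≤ Lam) (hS : S.IsHermitian)
    (hspec : spectrum ℝ S ⊆ Set.Icc lam Lam)
    (h : Tendsto (fun n : ℕ => (1 / (n : ℝ)) • gramMatrix (B n)) atTop (𝓝 S)) :
    ∀ᶠ n : ℕ in atTop, (∀ v : Fin K → ℝ, lam / 2 * n * ‖WithLp.toLp 2 v‖ ^ 2 ≤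
        ‖WithLp.toLp 2 ((B n).toMat *ᵥ v)‖ ^ 2) ∧ ‖(B n).toMat‖ ^ 2 ≤ 2 * Lam * n := by
  have h1 : Tendsto (fun n : ℕ => frob ((1 / (n : ℝ)) • gramMatrix (B n) - S)) atTop (𝓝 0) := by
    have h2 := (continuous_frob.tendsto _).comp (h.sub_const S)
    have h3 : frob (Matrix.of (S - S)) = 0 := by
      rw [sub_self]
      exact frob_zero
    rw [h3] at h2
    exact h2
  filter_upwards [h1.eventually (gt_mem_nhds (half_pos hlam)), eventually_gt_atTop 0] with n hn hn0
  have hn0' : (0 : ℝ) < n := by exact_mod_cast hn0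
  have hLam0 : 0 < Lam := hlam.trans_le hLam
  have key : ∀ v : Fin K → ℝ, |‖WithLp.toLp 2 ((B n).toMat *ᵥ v)‖ ^ 2 - n * (v ⬝ᵥ (S *ᵥ v))| ≤
      n * (lam / 2 * ‖WithLp.toLp 2 v‖ ^ 2) := by
    intro v
    have h2 : ‖WithLp.toLp 2 ((B n).toMat *ᵥ v)‖ ^ 2 - n * (v ⬝ᵥ (S *ᵥ v)) =
        n * (v ⬝ᵥ (((1 / (n : ℝ)) • gramMatrix (B n) - S) *ᵥ v)) := by
      rw [norm_mulVec_sq, ← Emb.gramMatrix_eq, Matrix.sub_mulVec, dotProduct_sub,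
        Matrix.smul_mulVec, dotProduct_smul, smul_eq_mul]
      field_simp
    rw [h2, abs_mul, abs_of_pos hn0']
    refine mul_le_mul_of_nonneg_left ?_ hn0'.le
    refine (abs_dotProduct_le _ _).trans ?_
    have h3 := (norm_mulVec_le ((1 / (n : ℝ)) • gramMatrix (B n) - S) v).trans
      (mul_le_mul_of_nonneg_right ((opNorm_le_frob _).trans hn.le) (norm_nonneg _))
    refine (mul_le_mul_of_nonneg_left h3 (norm_nonneg _)).trans_eq ?_
    ring
  constructor
  · intro v
    have h2 := (abs_le.1 (key v)).1
    have h3 := mul_le_mul_of_nonneg_left (quadForm_mem_of_spectrum hS hspec v).1 hn0'.le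
    linarith
  · have h4 : ‖(B n).toMat‖ ≤ √(2 * Lam * n) := by
      refine opNorm_le_of_forall _ (Real.sqrt_nonneg _) fun v => ?_
      refine abs_le_of_sq_le_sq' ?_ (by positivity) |>.2
      rw [mul_pow, Real.sq_sqrt (by positivity)]
      have h2 := (abs_le.1 (key v)).2
      have h3 := mul_le_mul_of_nonneg_left (quadForm_mem_of_spectrum hS hspec v).2 hn0'.le
      have h5 : n * (lam / 2 * ‖WithLp.toLp 2 v‖ ^ 2) ≤ n * (Lam * ‖WithLp.toLp 2 v‖ ^ 2) := by
        gcongr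
        linarith
      linarith
    refine (pow_le_pow_left₀ (norm_nonneg _) h4 2).trans_eq (Real.sq_sqrt (by positivity))

lemma frobNorm_sq_eq_trace {n K : ℕ} (X : Emb n K) : frobNorm X ^ 2 = (gramMatrix X).trace := by
  rw [Emb.frobNorm_eq, frob_sq, Finset.sum_comm, Emb.gramMatrix_eq]
  simp [Matrix.trace, Matrix.mul_apply, sq]

/-- The true embeddings eventually satisfy the constraints of the estimation problem. -/
lemma eventually_feasible {K₁ K₂ : ℕ} {f : ℝ → ℝ} {d₀ d₁ C κ : ℝ} {a : ℕ → ℝ}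
    {B : (n : ℕ) → Emb n K₁} {A : (n : ℕ) → Emb n K₂} {S₁ : Matrix (Fin K₁) (Fin K₁) ℝ}
    {S₂ : Matrix (Fin K₂) (Fin K₂) ℝ} (hκ : 0 < κ) (ha : ∀ n, 0 < a n)
    (h1 : CondA1 f d₀ d₁ C B A) (h2 : CondA2 B A) (h3 : CondA3 κ a B A S₁ S₂) :
    ∀ᶠ n in atTop, Feasible C κ (a n) (B n) (A n) := by
  have ht (K : ℕ) : Continuous fun X : Matrix (Fin K) (Fin K) ℝ => X.trace :=
    continuous_id.matrix_trace
  have hB := (((ht K₁).tendsto _).comp h3.tendsto₁).const_mul (κ ^ 2)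
  have hA := ((ht K₂).tendsto _).comp h3.tendsto₂
  -- Traces of Gram matrices are squared Frobenius norms, so the strict inequality of limiting
  -- traces becomes the scale constraint.
  filter_upwards [hA.eventually_lt hB h3.trace_lt, eventually_gt_atTop 0] with n hn hn0
  have hn0' : (0 : ℝ) < n := by exact_mod_cast hn0
  refine ⟨h1.bound_B n, h1.bound_A n, h2 n, ?_⟩
  have han := ha n
  simp only [Function.comp_apply, Matrix.trace_smul, ← frobNorm_sq_eq_trace, smul_eq_mul] at hn
  refine abs_le_of_sq_le_sq' ?_ (by
    have : 0 ≤ frobNorm (B n) := Real.sqrt_nonneg _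
    positivity) |>.2
  rw [mul_pow, mul_pow, Real.sq_sqrt han.le]
  have h4 : (n * a n) * (1 / (n * a n) * frobNorm (A n) ^ 2) ≤
      (n * a n) * (κ ^ 2 * (1 / n * frobNorm (B n) ^ 2)) :=
    mul_le_mul_of_nonneg_left hn.le (by positivity)
  have h5 : (n * a n) * (1 / (n * a n) * frobNorm (A n) ^ 2) = frobNorm (A n) ^ 2 := by
    field_simp
  have h6 : (n * a n) * (κ ^ 2 * (1 / n * frobNorm (B n) ^ 2)) =
      κ ^ 2 * a n * frobNorm (B n) ^ 2 := by
    field_simp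
  linarith

/-- For `K₁ = 0` the trace of `S₁` is zero, below which the trace of `S₂` cannot lie. Having `K₁ ≥
1` lets the factor `K₁` enter the error bounds. -/
lemma CondA3.pos_dim {K₁ K₂ : ℕ} {κ : ℝ} {a : ℕ → ℝ}
    {B : (n : ℕ) → Emb n K₁} {A : (n : ℕ) → Emb n K₂} {S₁ : Matrix (Fin K₁) (Fin K₁) ℝ}
    {S₂ : Matrix (Fin K₂) (Fin K₂) ℝ} (h : CondA3 κ a B A S₁ S₂) : 1 ≤ K₁ := by
  by_contra h0
  obtain rfl : K₁ = 0 := by omega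
  have h1 := h.trace_lt
  have h2 := h.posDef₂.posSemidef.trace_nonneg
  rw [Matrix.trace_fin_zero, mul_zero] at h1
  linarith

lemma minProportion_nonneg {n m : ℕ} (ψ : Fin n → Fin m) : 0 ≤ minProportion ψ :=
  Real.iInf_nonneg fun _ => by positivity

lemma minSeparation_nonneg {m K : ℕ} (b : Emb m K) : 0 ≤ minSeparation b :=
  Real.iInf_nonneg fun _ => norm_nonneg _

/-- The constant in the error bounds. -/
noncomputable def errorConst (ε lam Lam : ℝ) : ℝ :=
  8 * (2 + ε) * (256 * Lam ^ 2 / lam ^ 3) * 2592 / (lam / (6 * Lam)) ^ 2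

set_option maxHeartbeats 1000000 in
/-- The error bounds on the event that the operator norm of the score matrix is small. -/
theorem IsEstimate.errors_le {K₁ K₂ n m : ℕ} {f : ℝ → ℝ} {d₀ d₁ C κ a ε lam Lam η G H : ℝ}
    {B B' : Emb n K₁} {A A' : Emb n K₂} {b : Emb m K₁} {ψ ψhat : Fin n → Fin m}
    {y : Fin n → Fin n → ℤ}
    (hf : IsLink f) (hd : d₁ ≤ d₀) (hHdef : H = constH f d₀ d₁ (radius C d₀))
    (hG : 0 < G) (hH : 0 < H) (hn : 0 < n) (hK : 1 ≤ K₁) (hε : 0 ≤ ε) (hlam : 0 < lam)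
    (hLam : lam ≤ Lam) (hη1 : η ≤ lam / 2) (hη2 : 64 * Lam * η ^ 2 ≤ lam ^ 3)
    (ha : 0 ≤ a) (hfeas : Feasible C κ a B A)
    (hlow : ∀ v : Fin K₁ → ℝ, lam / 2 * n * ‖WithLp.toLp 2 v‖ ^ 2 ≤
      ‖WithLp.toLp 2 (B.toMat *ᵥ v)‖ ^ 2)
    (hB : ‖B.toMat‖ ^ 2 ≤ 2 * Lam * n) (hκη : κ ^ 2 * a * C ^ 2 ≤ η)
    (hrη : 36 * (G / H) * √(2 * (((K₁ + K₂ : ℕ) : ℝ) + 2)) * √n ≤ η * n)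
    (hb : ∀ i, B i = b (ψ i)) (hξ : 0 < minProportion ψ) (hζ : 0 < minSeparation b)
    (hsize : errorConst ε lam Lam * ((((K₁ + K₂ : ℕ) : ℝ) + 2) * G ^ 2 / H ^ 2) <
      minProportion ψ * minSeparation b ^ 2 * n)
    (hy : ∀ i j, y i j ∈ edgeSupport)
    (hW : ‖scoreMatrix f d₀ d₁ (paramM B A) y‖ ≤ 18 * G * √n)
    (hest : IsEstimate f d₀ d₁ C κ a y B' A') (hkm : IsApproxKMeans ε B' ψhat) :
    overallError ψ ψhat ≤
        errorBound (errorConst ε lam Lam) K₁ K₂ G H n (minSeparation b ^ 2) ∧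
      worstError ψ ψhat ≤ errorBound (errorConst ε lam Lam) K₁ K₂ G H n
        (minProportion ψ * minSeparation b ^ 2) := by
  have hn0 : (0 : ℝ) < n := by exact_mod_cast hn
  have hLam0 : 0 < Lam := hlam.trans_le hLam
  set T := (((K₁ + K₂ : ℕ) : ℝ) + 2) with hT
  have hT0 : 0 < T := by positivity
  set ξ := minProportion ψ with hξdef
  set ζ := minSeparation b with hζdef
  -- `36` is the `2` of the basic inequality times the `18` of the norm bound; the `2592` below is
  -- `2 * 36 ^ 2`.
  set e := 36 * (G / H) * √(2 * T) * √n with he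
  have hfrob : frob (2 • (B'.toMat * B'.toMatᵀ - B.toMat * B.toMatᵀ) +
      (A'.toMat * A'.toMatᵀ - A.toMat * A.toMatᵀ)) ≤ e := by
    refine (frob_gram_diff_le hfeas.centredOrth hest.1.centredOrth).trans ?_
    refine (hest.frob_paramDiff_le hf hd (hHdef ▸ hH) hy hfeas).trans ?_
    rw [← hHdef, ← hT]
    have : 2 / H * (‖scoreMatrix f d₀ d₁ (paramM B A) y‖ * √(2 * T)) ≤
        2 / H * (18 * G * √n * √(2 * T)) := by gcongr
    refine this.trans_eq ?_
    rw [he]; ring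
  have hsmall {B₀ : Emb n K₁} {A₀ : Emb n K₂} (h : Feasible C κ a B₀ A₀) :
      ‖A₀.toMat‖ ^ 2 ≤ η * n :=
    (h.norm_toMat_sq_le ha).trans (mul_le_mul_of_nonneg_right hκη hn0.le)
  obtain ⟨Q, hQ, hQlow⟩ := exists_alignment B.toMat B'.toMat A.toMat A'.toMat hn0 hlam hLam
    hη1 hη2 hfeas.centredOrth.transpose_mul hest.1.centredOrth.transpose_mul hlow hB
    (hsmall hfeas) (hsmall hest.1) hfrob hrη
  set q := lam / (6 * Lam) with hq
  have hq0 : 0 < q := by positivity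
  have hcost : 256 * Lam ^ 2 / lam ^ 3 * e ^ 2 / n =
      256 * Lam ^ 2 / lam ^ 3 * 2592 * (T * G ^ 2 / H ^ 2) := by
    have : e ^ 2 = 2592 * (T * G ^ 2 / H ^ 2) * n := by
      rw [he, mul_pow, mul_pow, mul_pow, Real.sq_sqrt (by positivity), Real.sq_sqrt hn0.le]
      ring
    rw [this]
    field_simp
  have hthr : 8 * (2 + ε) * (256 * Lam ^ 2 / lam ^ 3 * 2592 * (T * G ^ 2 / H ^ 2)) / (q * ζ) ^ 2 =
      errorConst ε lam Lam * (T * G ^ 2 / H ^ 2) / ζ ^ 2 := by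
    rw [errorConst, ← hq]
    field_simp
  have hc0 : 0 < errorConst ε lam Lam := by
    unfold errorConst
    positivity
  obtain ⟨p, S, hS, hpS⟩ := hkm.exists_perm (ψ := ψ)
    (z := fun l => WithLp.toLp 2 (Qᵀ *ᵥ (b l).ofLp)) hε (mul_pos hq0 hζ)
    (fun l k hlk => by
      have h1 := hQlow ((b l).ofLp - (b k).ofLp)
      rw [Matrix.mulVec_sub, WithLp.toLp_sub, WithLp.toLp_sub] at h1
      exact (mul_le_mul_of_nonneg_left (minSeparation_le b hlk) hq0.le).trans h1)
    ((kmeansCost_eq_frob hb Q).trans_le (hQ.trans_eq hcost))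
    (fun l => by
      rw [hthr, div_lt_iff₀ (by positivity)]
      refine hsize.trans_le ?_
      have := mul_le_mul_of_nonneg_right (minProportion_mul_le ψ l) (sq_nonneg ζ)
      linarith)
  rw [hthr] at hS
  have hK' : (1 : ℝ) ≤ K₁ := by exact_mod_cast hK
  have hnum : errorConst ε lam Lam * (T * G ^ 2 / H ^ 2) / ζ ^ 2 ≤
      errorConst ε lam Lam * (K₁ * T * G ^ 2) / (H ^ 2 * ζ ^ 2) := by
    rw [div_le_div_iff₀ (by positivity) (by positivity)]
    have h1 : errorConst ε lam Lam * (T * G ^ 2 / H ^ 2) * (H ^ 2 * ζ ^ 2) =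
        errorConst ε lam Lam * (1 * T * G ^ 2) * ζ ^ 2 := by field_simp
    rw [h1]
    gcongr
  constructor
  · refine (overallError_le hpS).trans
      ((div_le_div_of_nonneg_right (hS.trans hnum) hn0.le).trans_eq ?_)
    rw [errorBound, div_div]
    congr 1
    ring
  · refine (worstError_le hpS hξ hn).trans
      ((div_le_div_of_nonneg_right (hS.trans hnum) (by positivity)).trans_eq ?_)
    rw [errorBound, div_div]
    congr 1
    ring

lemma errorBound_isBigO (c : ℝ) (K₁ K₂ : ℕ) (G H : ℝ) {s : ℕ → ℝ}
    (hs : (fun _ : ℕ => (1 : ℝ)) =O[atTop] s) :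
    (fun n : ℕ => errorBound c K₁ K₂ G H n (s n)) =O[atTop] fun n : ℕ => 1 / (n : ℝ) := by
  have h1 : (fun n => (s n)⁻¹) =O[atTop] fun _ : ℕ => (1 : ℝ) := by
    simpa using hs.inv_rev (by simp)
  have h2 := ((isBigO_refl (fun n : ℕ => 1 / (n : ℝ)) atTop).mul h1).const_mul_left
    (c * ((K₁ : ℝ) * (((K₁ + K₂ : ℕ) : ℝ) + 2) * G ^ 2) / H ^ 2)
  simp only [mul_one] at h2
  refine h2.congr_left fun n => ?_
  rw [errorBound]
  simp only [div_eq_mul_inv, mul_inv, one_mul]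
  ring

/-- What the rate condition says about the community sizes and separations, for a fixed number
of nodes. -/
lemma separation_of_rate_le {K₁ K₂ n m : ℕ} {c G H : ℝ} {ψ : Fin n → Fin m} {b : Emb m K₁}
    (hc : 0 < c) (hG : 0 < G) (hH : 0 < H) (hn : 0 < n) (hK : 1 ≤ K₁)
    (h : ‖(K₁ : ℝ) * rate (K₁ + K₂) G H n ^ 2‖ ≤
      1 / c * ‖minProportion ψ * minSeparation b ^ 2‖) :
    0 < minProportion ψ ∧ 0 < minSeparation b ∧
      c * ((((K₁ + K₂ : ℕ) : ℝ) + 2) * G ^ 2 / H ^ 2) <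
        minProportion ψ * minSeparation b ^ 2 * n := by
  have hn0 : (0 : ℝ) < n := by exact_mod_cast hn
  have hK' : (1 : ℝ) ≤ K₁ := by exact_mod_cast hK
  have hξ := minProportion_nonneg ψ
  have hζ := minSeparation_nonneg b
  set T := (((K₁ + K₂ : ℕ) : ℝ) + 2) with hT
  have hT0 : 0 < T := by positivity
  set z := T * G ^ 2 / H ^ 2 with hz
  have hz0 : 0 < z := by positivity
  have hrate : rate (K₁ + K₂) G H n ^ 2 = 4.02 ^ 2 * 2 * z / n := by
    rw [rate, div_pow, mul_pow, mul_pow, ← hT, Real.sq_sqrt (by positivity), hz]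
    field_simp
  rw [hrate, Real.norm_of_nonneg (by positivity), Real.norm_of_nonneg (by positivity),
    one_div, inv_mul_eq_div, le_div_iff₀ hc, mul_div_assoc', div_mul_eq_mul_div,
    div_le_iff₀ hn0] at h
  -- Strict because `2 * 4.02 ^ 2 > 1`. It also excludes zero proportion or separation, including
  -- the default value `0` of the separation for fewer than two communities.
  have hlt : c * z < minProportion ψ * minSeparation b ^ 2 * n := by
    refine lt_of_lt_of_le ?_ h
    have h1 : 0 < c * z := by positivity
    have h2 : 1 * (c * z) ≤ K₁ * (c * z) := mul_le_mul_of_nonneg_right hK' h1.le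
    norm_num
    linarith
  have hpos : 0 < minProportion ψ * minSeparation b ^ 2 :=
    pos_of_mul_pos_left ((mul_pos hc hz0).trans hlt) hn0.le
  refine ⟨pos_of_mul_pos_left hpos (sq_nonneg _), ?_, hlt⟩
  refine lt_of_le_of_ne hζ fun h0 => ?_
  rw [← h0] at hpos
  norm_num at hpos

end Asymptotic

end SignedNet

/-! ### The main theorem -/

theorem mainTheorem3 :
    -- universal constants
    ∃ C₁ C₂ : ℝ, 0 < C₁ ∧ 0 < C₂ ∧
    -- `c` depends only on `ε` and on bounds for the spectrum of the limit matrix `S₁`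
    ∀ ε lam Lam : ℝ, 0 ≤ ε → 0 < lam → lam ≤ Lam → ∃ c : ℝ, 0 < c ∧
    ∀ (K₁ K₂ : ℕ) (f : ℝ → ℝ) (d₀ d₁ C κ : ℝ) (a : ℕ → ℝ)
      (B : (n : ℕ) → SignedNet.Emb n K₁) (A : (n : ℕ) → SignedNet.Emb n K₂)
      (S₁ : Matrix (Fin K₁) (Fin K₁) ℝ) (S₂ : Matrix (Fin K₂) (Fin K₂) ℝ)
      (m : ℕ → ℕ) (b : (n : ℕ) → SignedNet.Emb (m n) K₁)
      (ψ : (n : ℕ) → Fin n → Fin (m n)) (G H : ℝ),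
      SignedNet.IsLink f → d₁ ≤ d₀ → 0 < C → 0 < κ →
      (∀ n, 0 < a n) → Tendsto a atTop (𝓝 0) →
      SignedNet.CondA1 f d₀ d₁ C B A →
      SignedNet.CondA2 B A →
      SignedNet.CondA3 κ a B A S₁ S₂ →
      spectrum ℝ S₁ ⊆ Set.Icc lam Lam →
      SignedNet.CondA4 B m b ψ →
      G = SignedNet.constG f d₀ d₁ (SignedNet.radius C d₀) →
      H = SignedNet.constH f d₀ d₁ (SignedNet.radius C d₀) →
      (fun n => (K₁ : ℝ) * SignedNet.rate (K₁ + K₂) G H n ^ 2) =o[atTop]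
        (fun n => SignedNet.minProportion (ψ n) * SignedNet.minSeparation (b n) ^ 2) →
      -- the two error bounds, for every minimiser and every approximate K-means solution
      (∀ᶠ n : ℕ in atTop, ∀ (Ω : Type*) [MeasurableSpace Ω] (P : Measure Ω)
          [IsProbabilityMeasure P] (Y : Ω → Fin n → Fin n → ℤ),
          SignedNet.IsSignedNetwork P f d₀ d₁ (SignedNet.paramM (B n) (A n)) Y →
          1 - C₁ * Real.exp (-C₂ * n) ≤
            P.real {ω | ∀ (Bhat : SignedNet.Emb n K₁) (Ahat : SignedNet.Emb n K₂)
              (ψhat : Fin n → Fin (m n)),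
              SignedNet.IsEstimate f d₀ d₁ C κ (a n) (Y ω) Bhat Ahat →
              SignedNet.IsApproxKMeans ε Bhat ψhat →
              SignedNet.overallError (ψ n) ψhat ≤
                SignedNet.errorBound c K₁ K₂ G H n (SignedNet.minSeparation (b n) ^ 2) ∧
              SignedNet.worstError (ψ n) ψhat ≤
                SignedNet.errorBound c K₁ K₂ G H n
                  (SignedNet.minProportion (ψ n) * SignedNet.minSeparation (b n) ^ 2)}) ∧
      -- both bounds are `O(1 / n)` when `ξ` and `ζ` are bounded away from zero
      ((fun _ : ℕ => (1 : ℝ)) =O[atTop] (fun n => SignedNet.minProportion (ψ n)) →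
        (fun _ : ℕ => (1 : ℝ)) =O[atTop] (fun n => SignedNet.minSeparation (b n)) →
        (fun n : ℕ => SignedNet.errorBound c K₁ K₂ G H n
            (SignedNet.minSeparation (b n) ^ 2)) =O[atTop] (fun n : ℕ => 1 / (n : ℝ)) ∧
        (fun n : ℕ => SignedNet.errorBound c K₁ K₂ G H n
            (SignedNet.minProportion (ψ n) * SignedNet.minSeparation (b n) ^ 2))
          =O[atTop] (fun n : ℕ => 1 / (n : ℝ))) := by
  refine ⟨1, 1, one_pos, one_pos, fun ε lam Lam hε hlam hLam => ?_⟩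
  have hLam0 : 0 < Lam := hlam.trans_le hLam
  have hc : 0 < SignedNet.errorConst ε lam Lam := by
    unfold SignedNet.errorConst
    positivity
  refine ⟨SignedNet.errorConst ε lam Lam, hc, ?_⟩
  intro K₁ K₂ f d₀ d₁ C κ a B A S₁ S₂ m b ψ G H hf hd hC hκ ha ha0 h1 h2 h3 hspec h4 hGdef hHdef hr
  have hK := h3.pos_dim
  have hHpos := h1.H_pos
  have hGpos := hf.constG_pos hd (SignedNet.radius_pos hC d₀) h1.H_pos h1.G_finite
  have hG : 0 < G := hGdef ▸ hGpos
  have hH : 0 < H := hHdef ▸ hHpos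
  -- `η` is the smallness threshold of `exists_alignment`; for large `n` both `κ² a_n C²` and the
  -- relative error fall below it.
  obtain ⟨η, hη0, hη1, hη2⟩ : ∃ η : ℝ, 0 < η ∧ η ≤ lam / 2 ∧ 64 * Lam * η ^ 2 ≤ lam ^ 3 := by
    refine ⟨min (lam / 2) √(lam ^ 3 / (64 * Lam)), by positivity, min_le_left _ _, ?_⟩
    have h5 := pow_le_pow_left₀ (by positivity) (min_le_right (lam / 2) √(lam ^ 3 / (64 * Lam))) 2
    rw [Real.sq_sqrt (by positivity), le_div_iff₀ (by positivity)] at h5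
    linarith
  refine ⟨?_, fun hξ hζ => ⟨?_, ?_⟩⟩
  · have hκη : ∀ᶠ n in atTop, κ ^ 2 * a n * C ^ 2 ≤ η := by
      have h5 := (ha0.const_mul (κ ^ 2)).mul_const (C ^ 2)
      rw [mul_zero, zero_mul] at h5
      exact h5.eventually (ge_mem_nhds hη0)
    have hrη : ∀ᶠ n : ℕ in atTop,
        36 * (G / H) * √(2 * (((K₁ + K₂ : ℕ) : ℝ) + 2)) * √n ≤ η * n := by
      have h5 := (Real.tendsto_sqrt_atTop.comp tendsto_natCast_atTop_atTop).const_mul_atTop hη0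
      filter_upwards [h5.eventually_ge_atTop
        (36 * (G / H) * √(2 * (((K₁ + K₂ : ℕ) : ℝ) + 2)))] with n hn
      have h6 := mul_le_mul_of_nonneg_right hn (Real.sqrt_nonneg (n : ℝ))
      rwa [Function.comp_apply, mul_assoc η, Real.mul_self_sqrt (Nat.cast_nonneg n)] at h6
    -- The little-o condition is used with the single constant `1 / c`. None of these conditions on
    -- `n` involves the probability space.
    filter_upwards [hκη, hrη, hr.bound (one_div_pos.2 hc), eventually_gt_atTop 0,
      SignedNet.eventually_gram_bounds hlam hLam h3.posDef₁.isHermitian hspec h3.tendsto₁,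
      SignedNet.eventually_feasible hκ ha h1 h2 h3] with n hκη hrη hr hn hgram hfeas
    obtain ⟨hξ, hζ, hsize⟩ := SignedNet.separation_of_rate_le hc hG hH hn hK hr
    intro Ω _ P _ Y hY
    rw [one_mul, neg_one_mul]
    refine (hY.one_sub_exp_le_measureReal hf hd h1.H_pos h1.G_finite hGpos
      (SignedNet.abs_paramM_le d₀ (h1.bound_B n) (h1.bound_A n))
      (SignedNet.paramM_comm _ _)).trans (measureReal_mono ?_)
    intro ω hω Bhat Ahat ψhat hest hkm
    rw [← hGdef] at hω
    exact hest.errors_le hf hd hHdef hG hH hn hK hε hlam hLam hη1 hη2 (ha n).le hfeas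
      hgram.1 hgram.2 hκη hrη (h4 n) hξ hζ hsize (hY.mem_support ω) hω hkm
  · refine SignedNet.errorBound_isBigO _ _ _ _ _ ?_
    simpa using hζ.pow 2
  · refine SignedNet.errorBound_isBigO _ _ _ _ _ ?_
    simpa using hξ.mul (hζ.pow 2)
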